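/- Smoothness, manifolds and Lie groups are understood in the sense of the Michal--Bastiani calculus on real Hausdorff locally convex spaces: for $U \subseteq X$ open, a map $f : U \to Y$ is $C^1$ if it is continuous, all directional derivatives $df(x)(h)=\lim_{t\to 0}\frac1t(f(x+th)-f(x))$ exist and $df : U\times X \to Y$ is continuous; it is $C^n$ if it is $C^1$ and $df$ is $C^{n-1}$, and smooth if it is $C^n$ for all $n$. A Lie group $G$ is a group with a smooth manifold structure modelled on a locally convex space for which multiplication and inversion are smooth; its Lie algebra is $\mathbf{L}(G)=T_{\mathbf 1}(G)$ with the bracket of left invariant vector fields. A Lie group $G$ with Lie algebra $\mathfrak g$ is called regular if for each $\xi \in C^\infty([0,1],\mathfrak g)$ the initial value problem $\gamma(0)=\mathbf 1$, $\gamma'(t)=T(\lambda_{\gamma(t)})\xi(t)$ (where $\lambda_g(x)=gx$) has a solution $\gamma_\xi \in C^\infty([0,1],G)$, and the map $C^\infty([0,1],\mathfrak g)\to G$, $\xi\mapsto\gamma_\xi(1)$, is smooth. For a locally convex space $E$ and a finite-dimensional manifold $M$, or $M=[0,1]$, the space $C^\infty(M,E)$ carries the smooth compact open topology, i.e. the topology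 induced by $f \mapsto (T^k f)_{k \ge 0}$ from the compact open topologies on the spaces $C(T^kM,T^kE)$. Let $M$ be a connected (Hausdorff) finite-dimensional smooth manifold without boundary and $K$ a regular Lie group with Lie algebra $\mathfrak k$. A Lie group structure on the group $C^\infty(M,K)$ of smooth maps, with pointwise multiplication, is called compatible with evaluations if its Lie algebra is the topological Lie algebra $C^\infty(M,\mathfrak k)$ (with the pointwise bracket) and every evaluation map $\mathrm{ev}_m : C^\infty(M,K)\to K$, $f\mapsto f(m)$, $m \in M$, is smooth with $\mathbf L(\mathrm{ev}_m)=\mathrm{ev}_m : C^\infty(M,\mathfrak k)\to\mathfrak k$. (The topology of the Lie group structure is not assumed to be related to the smooth compact open topology on $C^\infty(M,K)$.) Then there is at most one regular Lie group structure on $C^\infty(M,K)$ which is compatible with evaluations: if $G_1$ and $G_2$ are the Lie groups obtained from two such structures, then the identity map $G_1\to G_2$ is a diffeomorphism. -/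

import Mathlib

namespace LCCalculus

open Set Filter Topology

universe u v w u₁ u₂ u₃

set_option linter.unusedSectionVars false

section Calculus

variable {X : Type u} [AddCommGroup X] [Module ℝ X] [TopologicalSpace X]
variable {X' : Type u₁} [AddCommGroup X'] [Module ℝ X'] [TopologicalSpace X']
variable {Y : Type v} [AddCommGroup Y] [Module ℝ Y] [TopologicalSpace Y]
variable {Y' : Type u₂} [AddCommGroup Y'] [Module ℝ Y'] [TopologicalSpace Y']
variable {Z : Type w} [AddCommGroup Z] [Module ℝ Z] [TopologicalSpace Z]

/-- `y` is the derivative of `f : U → Y` at `x ∈ U` in the direction `h`, i.e. the limit of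
`t⁻¹ • (f (x + t • h) - f x)` as `t → 0`, `t ≠ 0`. If `U` is open, the requirement
`x + t • h ∈ U` is void for small `t`; for `U = [0,1] ⊆ ℝ` it gives the one-sided derivatives at
the end points. -/
def HasDirDeriv (f : X → Y) (U : Set X) (x h : X) (y : Y) : Prop :=
  Tendsto (fun t : ℝ => t⁻¹ • (f (x + t • h) - f x)) (𝓝[{t : ℝ | t ≠ 0 ∧ x + t • h ∈ U}] 0) (𝓝 y)

/-- The derivative `df(x)(h)` of `f : U → Y`, as a function (meaningful where the limit exists). -/
noncomputable def dirDeriv (f : X → Y) (U : Set X) (x h : X) : Y :=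
  limUnder (𝓝[{t : ℝ | t ≠ 0 ∧ x + t • h ∈ U}] 0) (fun t : ℝ => t⁻¹ • (f (x + t • h) - f x))

/-- `f : U → Y` is a `C^n`-map: it is continuous and, if `n ≥ 1`, all directional derivatives exist
and `df : U × X → Y` is a `C^(n-1)`-map. Used for open `U`, for `U` open in `[0,1]`, and for products
of such sets with vector spaces. -/
def CnOn {Y : Type v} [AddCommGroup Y] [Module ℝ Y] [TopologicalSpace Y] :
    ℕ → ∀ {X : Type u} [AddCommGroup X] [Module ℝ X] [TopologicalSpace X], (X → Y) → Set X → Prop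
  | 0, _, _, _, _, f, U => ContinuousOn f U
  | n + 1, X, _, _, _, f, U => ContinuousOn f U ∧ ∃ df : X × X → Y,
      (∀ x ∈ U, ∀ h, HasDirDeriv f U x h (df (x, h))) ∧ CnOn n df (U ×ˢ univ)

/-- `f : U → Y` is smooth. -/
def SmoothOn (f : X → Y) (U : Set X) : Prop := ∀ n, CnOn n f U

theorem CnOn.continuousOn {n : ℕ} {f : X → Y} {U : Set X} (hf : CnOn n f U) : ContinuousOn f U := by
  cases n with
  | zero => exact hf
  | succ n => exact hf.1

theorem CnOn.of_succ {n : ℕ} : ∀ {X : Type u} [AddCommGroup X] [Module ℝ X] [TopologicalSpace X]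
    {f : X → Y} {U : Set X}, CnOn (n + 1) f U → CnOn n f U := by
  induction n with
  | zero => intro X _ _ _ f U h; exact h.1
  | succ n ih =>
    rintro X _ _ _ f U ⟨h, df, h1, h2⟩
    exact ⟨h, df, h1, ih h2⟩

theorem HasDirDeriv.mono {f : X → Y} {U W : Set X} {x h : X} {y : Y}
    (hf : HasDirDeriv f U x h y) (hW : W ⊆ U) : HasDirDeriv f W x h y :=
  hf.mono_left (nhdsWithin_mono _ fun _ ht => ⟨ht.1, hW ht.2⟩)

theorem HasDirDeriv.congr {f g : X → Y} {U : Set X} {x h : X} {y : Y}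
    (hf : HasDirDeriv f U x h y) (hx : x ∈ U) (hfg : EqOn f g U) : HasDirDeriv g U x h y := by
  refine Tendsto.congr' ?_ hf
  filter_upwards [self_mem_nhdsWithin] with t ht
  rw [hfg ht.2, hfg hx]

theorem CnOn.mono {n : ℕ} : ∀ {X : Type u} [AddCommGroup X] [Module ℝ X] [TopologicalSpace X]
    {f : X → Y} {U W : Set X}, CnOn n f U → W ⊆ U → CnOn n f W := by
  induction n with
  | zero => intro X _ _ _ f U W h hW; exact ContinuousOn.mono h hW
  | succ n ih =>
    rintro X _ _ _ f U W ⟨h, df, h1, h2⟩ hW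
    exact ⟨h.mono hW, df, fun x hx k => (h1 x (hW hx) k).mono hW,
      ih h2 (prod_mono hW Subset.rfl)⟩

theorem CnOn.congr {n : ℕ} {f g : X → Y} {U : Set X} (hf : CnOn n f U) (hfg : EqOn f g U) :
    CnOn n g U := by
  cases n with
  | zero => exact ContinuousOn.congr hf hfg.symm
  | succ n =>
    obtain ⟨h, df, h1, h2⟩ := hf
    exact ⟨h.congr hfg.symm, df, fun x hx k => (h1 x hx k).congr hx hfg, h2⟩

theorem CnOn.const {n : ℕ} (c : Y) :
    ∀ {X : Type u} [AddCommGroup X] [Module ℝ X] [TopologicalSpace X] (U : Set X),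
    CnOn n (fun _ : X => c) U := by
  induction n generalizing c with
  | zero => intro X _ _ _ U; exact continuousOn_const
  | succ n ih =>
    intro X _ _ _ U
    refine ⟨continuousOn_const, fun _ => 0, fun x _ k => ?_, ih 0 _⟩
    simp only [HasDirDeriv, sub_self, smul_zero]
    exact tendsto_const_nhds

theorem CnOn.prodMk {n : ℕ} : ∀ {X : Type u} [AddCommGroup X] [Module ℝ X] [TopologicalSpace X]
    {f : X → Y} {g : X → Y'} {U : Set X}, CnOn n f U → CnOn n g U →
    CnOn n (fun x => (f x, g x)) U := by
  induction n with
  | zero => intro X _ _ _ f g U hf hg; exact ContinuousOn.prodMk hf hg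
  | succ n ih =>
    rintro X _ _ _ f g U ⟨hf, df, hf1, hf2⟩ ⟨hg, dg, hg1, hg2⟩
    exact ⟨hf.prodMk hg, fun p => (df p, dg p),
      fun x hx k => (hf1 x hx k).prodMk_nhds (hg1 x hx k), ih hf2 hg2⟩

/-- Composition with a continuous linear map on the right. -/
theorem CnOn.comp_linear {n : ℕ} : ∀ {X : Type u} [AddCommGroup X] [Module ℝ X] [TopologicalSpace X]
    {X' : Type u₁} [AddCommGroup X'] [Module ℝ X'] [TopologicalSpace X']
    {f : X → Y} {U : Set X}, CnOn n f U → ∀ L : X' →L[ℝ] X, CnOn n (fun x => f (L x)) (L ⁻¹' U) := by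
  induction n with
  | zero =>
    intro X _ _ _ X' _ _ _ f U hf L
    exact ContinuousOn.comp hf L.continuous.continuousOn fun x hx => hx
  | succ n ih =>
    rintro X _ _ _ X' _ _ _ f U ⟨hf, df, hf1, hf2⟩ L
    refine ⟨hf.comp L.continuous.continuousOn fun x hx => hx,
      fun p => df (L p.1, L p.2), fun x hx k => ?_, ?_⟩
    · have := hf1 (L x) hx (L k)
      simpa [HasDirDeriv, map_add, map_smul] using this
    · have := ih hf2 (L.prodMap L)
      refine this.mono ?_
      rintro ⟨a, b⟩ hab
      simpa using hab

/-- Composition with a continuous linear map on the left. -/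
theorem CnOn.linear_comp {n : ℕ} (L : Y →L[ℝ] Y') :
    ∀ {X : Type u} [AddCommGroup X] [Module ℝ X] [TopologicalSpace X]
    {f : X → Y} {U : Set X}, CnOn n f U → CnOn n (fun x => L (f x)) U := by
  induction n with
  | zero => intro X _ _ _ f U hf; exact L.continuous.comp_continuousOn hf
  | succ n ih =>
    rintro X _ _ _ f U ⟨hf, df, hf1, hf2⟩
    refine ⟨L.continuous.comp_continuousOn hf, fun p => L (df p), fun x hx k => ?_, ih hf2⟩
    have := (L.continuous.tendsto _).comp (hf1 x hx k)
    simpa [HasDirDeriv, Function.comp_def, map_sub, map_smul] using this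

section Chain

variable [IsTopologicalAddGroup Y] [ContinuousSMul ℝ Y]
variable [IsTopologicalAddGroup Z] [ContinuousSMul ℝ Z] [LocallyConvexSpace ℝ Z]

/-- Mean value estimate along a segment. -/
theorem segment_mem {g : Y → Z} {V : Set Y} {dg : Y × Y → Z} (hV : IsOpen V)
    (hg : ∀ y ∈ V, ∀ k, HasDirDeriv g V y k (dg (y, k)))
    {W : Set Z} (hW : Convex ℝ W) (hWc : IsClosed W) {y k : Y} {t : ℝ} (ht : t ≠ 0)
    (hseg : ∀ s ∈ Icc (0 : ℝ) 1, y + (s * t) • k ∈ V ∧ dg (y + (s * t) • k, k) ∈ W) :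
    t⁻¹ • (g (y + t • k) - g y) ∈ W := by
  by_contra hn
  obtain ⟨l, c, hl, hc⟩ := geometric_hahn_banach_closed_point hW hWc hn
  let φ : ℝ → ℝ := fun s => t⁻¹ * l (g (y + (s * t) • k))
  have hφ : ∀ s ∈ Icc (0 : ℝ) 1, HasDerivAt φ (l (dg (y + (s * t) • k, k))) s := by
    intro s hs
    obtain ⟨hy, -⟩ := hseg s hs
    have h1 := (l.continuous.tendsto _).comp (hg _ hy k)
    rw [hasDerivAt_iff_tendsto_slope_zero]
    have h2 : Tendsto (fun r : ℝ => r * t) (𝓝[≠] 0)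
        (𝓝[{r : ℝ | r ≠ 0 ∧ y + (s * t) • k + r • k ∈ V}] 0) := by
      have h3 : Tendsto (fun r : ℝ => r * t) (𝓝 0) (𝓝 0) := by
        simpa using (continuous_mul_const t).tendsto (0 : ℝ)
      refine tendsto_nhdsWithin_iff.2 ⟨h3.mono_left nhdsWithin_le_nhds, ?_⟩
      have h4 : Tendsto (fun r : ℝ => y + (s * t) • k + (r * t) • k) (𝓝 0)
          (𝓝 (y + (s * t) • k)) := by
        have h5 : Continuous fun r : ℝ => y + (s * t) • k + (r * t) • k := by fun_prop
        simpa using h5.tendsto 0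
      filter_upwards [self_mem_nhdsWithin,
        (h4.eventually (hV.mem_nhds hy)).filter_mono nhdsWithin_le_nhds] with r hr hr'
      exact ⟨mul_ne_zero hr ht, hr'⟩
    refine (h1.comp h2).congr' ?_
    filter_upwards [self_mem_nhdsWithin] with r hr
    have h6 : y + (s * t) • k + (r * t) • k = y + ((s + r) * t) • k := by
      rw [add_assoc, ← add_smul, ← add_mul]
    simp only [Function.comp_apply, h6, map_smul, map_sub, smul_eq_mul, φ, mul_inv]
    ring
  obtain ⟨s, hs, hs'⟩ := exists_hasDerivAt_eq_slope φ
    (fun s => l (dg (y + (s * t) • k, k))) zero_lt_one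
    (fun s hs => (hφ s hs).continuousAt.continuousWithinAt)
    (fun s hs => hφ s ⟨hs.1.le, hs.2.le⟩)
  have h7 := hl _ (hseg s ⟨hs.1.le, hs.2.le⟩).2
  have h8 : l (t⁻¹ • (g (y + t • k) - g y)) = φ 1 - φ 0 := by
    simp [φ, mul_sub]
  simp only [sub_zero, div_one] at hs'
  rw [hs', ← h8] at h7
  exact absurd (h7.trans hc) (lt_irrefl _)

/-- The chain rule for directional derivatives. -/
theorem HasDirDeriv.comp {f : X → Y} {g : Y → Z} {U : Set X} {V : Set Y} (hV : IsOpen V)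
    (hUV : MapsTo f U V) {dg : Y × Y → Z} (hg : ∀ y ∈ V, ∀ k, HasDirDeriv g V y k (dg (y, k)))
    (hdg : ContinuousOn dg (V ×ˢ univ)) {x h : X} (hx : x ∈ U) {k : Y}
    (hf : HasDirDeriv f U x h k) : HasDirDeriv (fun x => g (f x)) U x h (dg (f x, k)) := by
  rw [HasDirDeriv, ((closed_nhds_basis (dg (f x, k)))).tendsto_right_iff]
  rintro W₀ ⟨hW₀, hW₀c⟩
  obtain ⟨W, ⟨hW, hWconv⟩, hWW₀⟩ :=
    (LocallyConvexSpace.convex_basis (𝕜 := ℝ) (dg (f x, k))).mem_iff.1 hW₀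
  have hcl : closure W ⊆ W₀ := closure_minimal hWW₀ hW₀c
  have hWcl : closure W ∈ 𝓝 (dg (f x, k)) := mem_of_superset hW subset_closure
  have hopen : IsOpen (V ×ˢ (univ : Set Y)) := hV.prod isOpen_univ
  have hmem : (f x, k) ∈ V ×ˢ (univ : Set Y) := ⟨hUV hx, trivial⟩
  have hA : {p : Y × Y | p ∈ V ×ˢ (univ : Set Y) ∧ dg p ∈ closure W} ∈ 𝓝 (f x, k) := by
    filter_upwards [hopen.mem_nhds hmem, (hdg.continuousAt (hopen.mem_nhds hmem)) hWcl]
      with p hp hp' using ⟨hp, hp'⟩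
  have hcont : Continuous fun q : ℝ × Y => (f x + q.1 • q.2, q.2) := by fun_prop
  have hB : {q : ℝ × Y | (f x + q.1 • q.2, q.2) ∈
      {p : Y × Y | p ∈ V ×ˢ (univ : Set Y) ∧ dg p ∈ closure W}} ∈ 𝓝 ((0 : ℝ), k) := by
    refine hcont.continuousAt ?_
    simpa using hA
  rw [nhds_prod_eq, mem_prod_iff] at hB
  obtain ⟨R, hR, B, hB, hRB⟩ := hB
  obtain ⟨ε, hε, hεR⟩ := Metric.mem_nhds_iff.1 hR
  have ht0 : ∀ᶠ t : ℝ in 𝓝[{t : ℝ | t ≠ 0 ∧ x + t • h ∈ U}] 0, t ∈ Metric.ball (0 : ℝ) ε :=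
    nhdsWithin_le_nhds (Metric.ball_mem_nhds _ hε)
  filter_upwards [self_mem_nhdsWithin, hf hB, ht0] with t ht hk hε'
  refine hcl ?_
  have hfx : f (x + t • h) = f x + t • (t⁻¹ • (f (x + t • h) - f x)) := by
    rw [smul_inv_smul₀ ht.1]; abel
  rw [hfx]
  refine segment_mem hV hg hWconv.closure isClosed_closure ht.1 fun s hs => ?_
  have hst : s * t ∈ R := by
    apply hεR
    rw [mem_ball_zero_iff, Real.norm_eq_abs] at hε' ⊢
    rw [abs_mul]
    calc |s| * |t| ≤ 1 * |t| := by
          gcongr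
          rw [abs_of_nonneg hs.1]; exact hs.2
      _ < ε := by simpa using hε'
  have := hRB (mk_mem_prod hst hk)
  exact ⟨this.1.1, this.2⟩

end Chain

/-- Composition of `C^n`-maps. -/
theorem CnOn.comp [IsTopologicalAddGroup Z] [ContinuousSMul ℝ Z] [LocallyConvexSpace ℝ Z] {n : ℕ} :
    ∀ {X : Type u} [AddCommGroup X] [Module ℝ X] [TopologicalSpace X]
    {Y : Type v} [AddCommGroup Y] [Module ℝ Y] [TopologicalSpace Y] [IsTopologicalAddGroup Y]
    [ContinuousSMul ℝ Y] {g : Y → Z} {f : X → Y} {U : Set X} {V : Set Y}, IsOpen V →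
    CnOn n g V → CnOn n f U → MapsTo f U V → CnOn n (fun x => g (f x)) U := by
  induction n with
  | zero =>
    intro X _ _ _ Y _ _ _ _ _ g f U V _ hg hf hUV
    exact ContinuousOn.comp hg hf hUV
  | succ n ih =>
    intro X _ _ _ Y _ _ _ _ _ g f U V hV hg hf hUV
    have hf' := hf.of_succ
    obtain ⟨hgc, dg, hg1, hg2⟩ := hg
    obtain ⟨hfc, df, hf1, hf2⟩ := hf
    refine ⟨hgc.comp hfc hUV, fun p => dg (f p.1, df p),
      fun x hx h => (hf1 x hx h).comp hV hUV hg1 hg2.continuousOn hx, ?_⟩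
    have h1 : CnOn n (fun p : X × X => f p.1) (U ×ˢ univ) := by
      refine (hf'.comp_linear (ContinuousLinearMap.fst ℝ X X)).mono ?_
      rintro ⟨a, b⟩ hab
      exact hab.1
    exact ih (hV.prod isOpen_univ) hg2 (h1.prodMk hf2) fun p hp => ⟨hUV hp.1, trivial⟩

theorem dir_neBot [IsTopologicalAddGroup X] [ContinuousSMul ℝ X] {U : Set X} (hU : IsOpen U)
    {x : X} (hx : x ∈ U) (h : X) : (𝓝[{t : ℝ | t ≠ 0 ∧ x + t • h ∈ U}] (0 : ℝ)).NeBot := by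
  have hc : Tendsto (fun t : ℝ => x + t • h) (𝓝 0) (𝓝 x) := by
    have : Continuous fun t : ℝ => x + t • h := by fun_prop
    simpa using this.tendsto 0
  have hmem : (fun t : ℝ => x + t • h) ⁻¹' U ∈ 𝓝 (0 : ℝ) := hc (hU.mem_nhds hx)
  have : 𝓝[{t : ℝ | t ≠ 0 ∧ x + t • h ∈ U}] (0 : ℝ) = 𝓝[≠] 0 := by
    have h2 : {t : ℝ | t ≠ 0 ∧ x + t • h ∈ U} = {0}ᶜ ∩ (fun t : ℝ => x + t • h) ⁻¹' U := rfl
    rw [h2, nhdsWithin_inter_of_mem' (nhdsWithin_le_nhds hmem)]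
  rw [this]
  infer_instance

theorem HasDirDeriv.of_inter [IsTopologicalAddGroup X] [ContinuousSMul ℝ X] {f : X → Y}
    {U V : Set X} (hV : IsOpen V) {x h : X} {y : Y} (hx : x ∈ V)
    (hf : HasDirDeriv f (U ∩ V) x h y) : HasDirDeriv f U x h y := by
  have hc : Tendsto (fun t : ℝ => x + t • h) (𝓝 0) (𝓝 x) := by
    have : Continuous fun t : ℝ => x + t • h := by fun_prop
    simpa using this.tendsto 0
  have hmem : (fun t : ℝ => x + t • h) ⁻¹' V ∈ 𝓝 (0 : ℝ) := hc (hV.mem_nhds hx)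
  have h2 : {t : ℝ | t ≠ 0 ∧ x + t • h ∈ U ∩ V} =
      {t : ℝ | t ≠ 0 ∧ x + t • h ∈ U} ∩ (fun t : ℝ => x + t • h) ⁻¹' V := by
    ext t; simp [and_assoc]
  rw [HasDirDeriv, h2, nhdsWithin_inter_of_mem' (nhdsWithin_le_nhds hmem)] at hf
  exact hf

/-- Being `C^n` is a local property. -/
theorem CnOn.of_local [T2Space Y] {n : ℕ} :
    ∀ {X : Type u} [AddCommGroup X] [Module ℝ X] [TopologicalSpace X]
    [IsTopologicalAddGroup X] [ContinuousSMul ℝ X] {f : X → Y} {U : Set X}, IsOpen U →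
    (∀ x ∈ U, ∃ V, IsOpen V ∧ x ∈ V ∧ CnOn n f (U ∩ V)) → CnOn n f U := by
  induction n with
  | zero =>
    intro X _ _ _ _ _ f U hU hf
    exact continuousOn_of_locally_continuousOn fun x hx => hf x hx
  | succ n ih =>
    intro X _ _ _ _ _ f U hU hf
    have hcont : ContinuousOn f U := continuousOn_of_locally_continuousOn fun x hx =>
      let ⟨V, hV, hxV, h⟩ := hf x hx
      ⟨V, hV, hxV, h.continuousOn⟩
    have hf' : ∀ x : U, ∃ V, IsOpen V ∧ x.1 ∈ V ∧ ∃ df : X × X → Y,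
        (∀ z ∈ U ∩ V, ∀ h, HasDirDeriv f (U ∩ V) z h (df (z, h))) ∧
          CnOn n df ((U ∩ V) ×ˢ univ) := fun x =>
      let ⟨V, hV, hxV, h⟩ := hf x.1 x.2
      ⟨V, hV, hxV, h.2⟩
    choose V hV hxV D hD1 hD2 using hf'
    classical
    let df : X × X → Y := fun p => if hp : p.1 ∈ U then D ⟨p.1, hp⟩ p else 0
    have hdf : ∀ x ∈ U, ∀ h, HasDirDeriv f U x h (df (x, h)) := by
      intro x hx h
      simp only [df, hx, dif_pos]
      exact (hD1 ⟨x, hx⟩ x ⟨hx, hxV _⟩ h).of_inter (hV _) (hxV ⟨x, hx⟩)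
    refine ⟨hcont, df, hdf, ih (hU.prod isOpen_univ) ?_⟩
    rintro ⟨x, h⟩ ⟨hx, -⟩
    refine ⟨V ⟨x, hx⟩ ×ˢ univ, (hV _).prod isOpen_univ, ⟨hxV ⟨x, hx⟩, trivial⟩, ?_⟩
    have hsub : U ×ˢ (univ : Set X) ∩ V ⟨x, hx⟩ ×ˢ univ = (U ∩ V ⟨x, hx⟩) ×ˢ univ := by
      rw [prod_inter_prod, univ_inter]
    rw [hsub]
    refine (hD2 ⟨x, hx⟩).congr ?_
    rintro ⟨z, k⟩ ⟨⟨hzU, hzV⟩, -⟩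
    have := dir_neBot hU hzU k
    exact tendsto_nhds_unique ((hD1 ⟨x, hx⟩ z ⟨hzU, hzV⟩ k).of_inter (hV _) hzV) (hdf z hzU k)

end Calculus

section SmoothCompactOpen

/-- The tangent map `Tf : U × X → Y × Y`, `(x, h) ↦ (f x, df(x)(h))`. -/
noncomputable def tangentMap {X : Type u} [AddCommGroup X] [Module ℝ X] [TopologicalSpace X]
    {Y : Type v} [AddCommGroup Y] [Module ℝ Y] [TopologicalSpace Y] (U : Set X) (f : X → Y) :
    X × X → Y × Y :=
  fun p => (f p.1, dirDeriv f U p.1 p.2)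

/-- The topology on maps `f : U → Y` induced by `f ↦ T^k f : T^k U → T^k Y` from the compact open
topology, where `T^0 U = U` and `T^(k+1) U = T^k (U × X)`. -/
@[reducible] noncomputable def tangentCompactOpen : ℕ → ∀ {X : Type u} [AddCommGroup X] [Module ℝ X] [TopologicalSpace X]
    {Y : Type v} [AddCommGroup Y] [Module ℝ Y] [TopologicalSpace Y],
    Set X → TopologicalSpace (X → Y)
  | 0, _, _, _, _, _, _, _, _, U => TopologicalSpace.generateFrom
      {s | ∃ C V, IsCompact C ∧ C ⊆ U ∧ IsOpen V ∧ s = {f | MapsTo f C V}}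
  | k + 1, _, _, _, _, _, _, _, _, U =>
      (tangentCompactOpen k (U ×ˢ univ)).induced (tangentMap U)

end SmoothCompactOpen

/-! ### Manifolds modelled on locally convex spaces -/

section Manifold

variable {E : Type u} [AddCommGroup E] [Module ℝ E] [TopologicalSpace E]
variable {F : Type v} [AddCommGroup F] [Module ℝ F] [TopologicalSpace F]
variable {H : Type w} [AddCommGroup H] [Module ℝ H] [TopologicalSpace H]
variable {M : Type u₁} [TopologicalSpace M]
variable {N : Type u₂} [TopologicalSpace N]
variable {P : Type u₃} [TopologicalSpace P]

instance : AddCommGroup (ModelProd E F) := inferInstanceAs (AddCommGroup (E × F))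

instance : Module ℝ (ModelProd E F) := inferInstanceAs (Module ℝ (E × F))

/-- The map `f : M → N` in the charts `e` of `M` and `e'` of `N`. -/
def localRep (e : OpenPartialHomeomorph M E) (e' : OpenPartialHomeomorph N F) (f : M → N) : E → F :=
  fun x => e' (f (e.symm x))

/-- The domain of definition of `localRep e e' f`. -/
def localDom (e : OpenPartialHomeomorph M E) (e' : OpenPartialHomeomorph N F) (f : M → N) : Set E :=
  e.target ∩ e.symm ⁻¹' (f ⁻¹' e'.source)

variable (E F)

/-- `M` is a smooth manifold modelled on `E`: all changes of charts are smooth. -/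
class IsLCManifold (M : Type u₁) [TopologicalSpace M] [ChartedSpace E M] : Prop where
  smooth_chart_change : ∀ e ∈ atlas E M, ∀ e' ∈ atlas E M,
    SmoothOn (localRep e e' id) (localDom e e' id)

/-- Smooth maps between manifolds modelled on `E` and `F`. -/
def Smooth [ChartedSpace E M] [ChartedSpace F N] (f : M → N) : Prop :=
  Continuous f ∧ ∀ e ∈ atlas E M, ∀ e' ∈ atlas F N, SmoothOn (localRep e e' f) (localDom e e' f)

/-- The tangent map `T_p f : T_p M → T_(f p) N`. As usual for charted spaces, `T_p M` is identified
with the model space by means of the preferred chart `chartAt E p` at `p`. -/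
noncomputable def tangentMapAt [ChartedSpace E M] [ChartedSpace F N] (f : M → N) (p : M) (v : E) :
    F :=
  dirDeriv (localRep (chartAt E p) (chartAt F (f p)) f)
    (localDom (chartAt E p) (chartAt F (f p)) f) (chartAt E p p) v

variable {E F}

theorem isOpen_localDom (e : OpenPartialHomeomorph M E) (e' : OpenPartialHomeomorph N F) {f : M → N}
    (hf : Continuous f) : IsOpen (localDom e e' f) :=
  e.isOpen_inter_preimage_symm (e'.open_source.preimage hf)

theorem Smooth.const [ChartedSpace E M] [ChartedSpace F N] (c : N) :
    Smooth E F (fun _ : M => c) :=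
  ⟨continuous_const, fun _ _ _ _ _ => CnOn.const _ _⟩

theorem Smooth.comp [IsTopologicalAddGroup E] [ContinuousSMul ℝ E]
    [IsTopologicalAddGroup F] [ContinuousSMul ℝ F]
    [IsTopologicalAddGroup H] [ContinuousSMul ℝ H] [LocallyConvexSpace ℝ H] [T2Space H]
    [ChartedSpace E M] [ChartedSpace F N] [ChartedSpace H P] {g : N → P} {f : M → N}
    (hg : Smooth F H g) (hf : Smooth E F f) : Smooth E H (fun x => g (f x)) := by
  have hc : Continuous fun x => g (f x) := hg.1.comp hf.1
  refine ⟨hc, fun e he e'' he'' n => ?_⟩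
  refine CnOn.of_local (isOpen_localDom e e'' hc) fun x hx => ?_
  let e' := chartAt F (f (e.symm x))
  have he' : e' ∈ atlas F N := chart_mem_atlas F _
  refine ⟨localDom e e' f, isOpen_localDom e e' hf.1, ⟨hx.1, mem_chart_source F _⟩, ?_⟩
  have h1 : CnOn n (localRep e e' f) (localDom e e'' (fun x => g (f x)) ∩ localDom e e' f) :=
    (hf.2 e he e' he' n).mono inter_subset_right
  have h2 := hg.2 e' he' e'' he'' n
  have hmaps : MapsTo (localRep e e' f) (localDom e e'' (fun x => g (f x)) ∩ localDom e e' f)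
      (localDom e' e'' g) := by
    rintro y ⟨hy1, hy2⟩
    refine ⟨e'.map_source hy2.2, ?_⟩
    have h3 : e'.symm (e' (f (e.symm y))) = f (e.symm y) := e'.left_inv hy2.2
    simp only [localRep, mem_preimage, h3]
    exact hy1.2
  refine (CnOn.comp (isOpen_localDom e' e'' hg.1) h2 h1 hmaps).congr ?_
  rintro y ⟨hy1, hy2⟩
  have h3 : e'.symm (e' (f (e.symm y))) = f (e.symm y) := e'.left_inv hy2.2
  simp only [localRep, h3]

theorem Smooth.prodMk [ChartedSpace E M] [ChartedSpace F N] [ChartedSpace H P]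
    {f : M → N} {g : M → P} (hf : Smooth E F f) (hg : Smooth E H g) :
    Smooth E (ModelProd F H) (fun x => (f x, g x)) := by
  refine ⟨hf.1.prodMk hg.1, ?_⟩
  rintro e he e' ⟨e₁, he₁, e₂, he₂, rfl⟩ n
  have h1 := (hf.2 e he e₁ he₁ n).mono (W := localDom e e₁ f ∩ localDom e e₂ g) inter_subset_left
  have h2 := (hg.2 e he e₂ he₂ n).mono (W := localDom e e₁ f ∩ localDom e e₂ g) inter_subset_right
  refine (h1.prodMk h2).mono ?_
  rintro x ⟨hx1, hx2⟩
  exact ⟨⟨hx1, hx2.1⟩, ⟨hx1, hx2.2⟩⟩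

end Manifold

/-! ### Lie groups -/

section LieGroup

variable (E : Type u) [AddCommGroup E] [Module ℝ E] [TopologicalSpace E]

/-- `G` is a Lie group modelled on `E`. -/
class IsLCLieGroup (G : Type v) [TopologicalSpace G] [ChartedSpace E G] [Group G] : Prop
    extends IsLCManifold E G where
  smooth_mul : Smooth (ModelProd E E) E (fun p : G × G => p.1 * p.2)
  smooth_inv : Smooth E E (fun g : G => g⁻¹)

variable {G : Type v} [TopologicalSpace G] [ChartedSpace E G] [Group G]

/-- The left invariant vector field `x_l(g) = T_1(λ_g) x` on `G`, in the chart `e` at `1`: its value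
at the point `p = e g`. -/
noncomputable def leftField (G : Type v) [TopologicalSpace G] [ChartedSpace E G] [Group G]
    (x : E) (p : E) : E :=
  let e := chartAt E (1 : G)
  dirDeriv (localRep e e (fun g => e.symm p * g)) (localDom e e (fun g => e.symm p * g)) (e 1) x

/-- The Lie bracket on `T_1 G` (identified with `E` by the chart `e` at `1`), i.e. the value in `1`
of the Lie bracket `[X, Y] = dY(X) - dX(Y)` of the left invariant vector fields `X = x_l`,
`Y = y_l`. -/
noncomputable def lieBracket (G : Type v) [TopologicalSpace G] [ChartedSpace E G] [Group G]
    (x y : E) : E :=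
  let e := chartAt E (1 : G)
  dirDeriv (leftField E G y) e.target (e 1) x - dirDeriv (leftField E G x) e.target (e 1) y

end LieGroup

/-! ### Smooth curves on `I = [0,1]` and regular Lie groups -/

section Regular

/-- A curve on `[0,1]` as a function on `ℝ`; only its values on `[0,1]` are used. -/
noncomputable def extendPath {G : Type v} (γ : unitInterval → G) : ℝ → G := IccExtend zero_le_one γ

variable (E : Type u) [AddCommGroup E] [Module ℝ E] [TopologicalSpace E]

/-- Smooth curves `[0,1] → G`. -/
def SmoothPath {G : Type v} [TopologicalSpace G] [ChartedSpace E G] (γ : unitInterval → G) : Prop :=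
  Continuous γ ∧ ∀ e ∈ atlas E G,
    SmoothOn (fun t => e (extendPath γ t)) (Icc 0 1 ∩ extendPath γ ⁻¹' e.source)

/-- The derivative `γ'(t)` of a smooth curve, in `T_(γ t) G`. -/
noncomputable def pathDeriv {G : Type v} [TopologicalSpace G] [ChartedSpace E G]
    (γ : unitInterval → G) (t : unitInterval) : E :=
  let e := chartAt E (γ t)
  dirDeriv (fun s => e (extendPath γ s)) (Icc 0 1 ∩ extendPath γ ⁻¹' e.source) (t : ℝ) 1

variable [IsTopologicalAddGroup E] [ContinuousSMul ℝ E]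

/-- The vector space of smooth curves `[0,1] → E`. -/
noncomputable def smoothPaths : Submodule ℝ (unitInterval → E) where
  carrier := {ξ | SmoothOn (extendPath ξ) (Icc 0 1)}
  zero_mem' := fun _ => CnOn.const 0 _
  add_mem' := fun ha hb n => CnOn.linear_comp
    (ContinuousLinearMap.fst ℝ E E + ContinuousLinearMap.snd ℝ E E) ((ha n).prodMk (hb n))
  smul_mem' := fun c _ ha n => CnOn.linear_comp (c • ContinuousLinearMap.id ℝ E) (ha n)

/-- The locally convex space `C^∞([0,1], E)`. -/
def PathSpace : Type u := ↥(smoothPaths E)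

noncomputable instance : AddCommGroup (PathSpace E) := inferInstanceAs (AddCommGroup ↥(smoothPaths E))

noncomputable instance : Module ℝ (PathSpace E) := inferInstanceAs (Module ℝ ↥(smoothPaths E))

/-- The smooth compact open topology on `C^∞([0,1], E)`. -/
noncomputable instance : TopologicalSpace (PathSpace E) :=
  ⨅ k : ℕ, (tangentCompactOpen k (Icc (0 : ℝ) 1)).induced fun ξ => extendPath ξ.1

/-- `G` is a regular Lie group: for each `ξ ∈ C^∞([0,1], 𝔤)` the initial value problem `γ(0) = 1`,
`γ'(t) = T_1(λ_(γ t)) ξ(t)` has a solution `γ_ξ ∈ C^∞([0,1], G)` and the evolution map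
`C^∞([0,1], 𝔤) → G`, `ξ ↦ γ_ξ(1)` is smooth. -/
def IsRegular (G : Type v) [TopologicalSpace G] [ChartedSpace E G] [Group G] : Prop :=
  ∃ Evol : PathSpace E → unitInterval → G,
    (∀ ξ, SmoothPath E (Evol ξ) ∧ Evol ξ 0 = 1 ∧
      ∀ t, pathDeriv E (Evol ξ) t = tangentMapAt E E (fun g : G => Evol ξ t * g) 1 (ξ.1 t)) ∧
    Smooth (PathSpace E) E (fun ξ => Evol ξ 1)

end Regular

/-! ### The group `C^∞(M,K)` and the Lie algebra `C^∞(M,𝔨)` -/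

section MappingGroup

variable (F : Type u) [AddCommGroup F] [Module ℝ F] [TopologicalSpace F]
variable (M : Type u₁) [TopologicalSpace M] [ChartedSpace F M]

/-- The vector space of smooth maps `M → E`. -/
def smoothFunctions (E : Type v) [AddCommGroup E] [Module ℝ E] [TopologicalSpace E]
    [IsTopologicalAddGroup E] [ContinuousSMul ℝ E] : Submodule ℝ (M → E) where
  carrier := {f | Smooth F E f}
  zero_mem' := Smooth.const 0
  add_mem' := by
    rintro a b ⟨hac, ha⟩ ⟨hbc, hb⟩
    refine ⟨hac.add hbc, ?_⟩
    rintro e he e' rfl n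
    exact CnOn.linear_comp (ContinuousLinearMap.fst ℝ E E + ContinuousLinearMap.snd ℝ E E)
      ((ha e he _ rfl n).prodMk (hb e he _ rfl n))
  smul_mem' := by
    rintro c a ⟨hac, ha⟩
    refine ⟨hac.const_smul c, ?_⟩
    rintro e he e' rfl n
    exact CnOn.linear_comp (c • ContinuousLinearMap.id ℝ E) (ha e he _ rfl n)

/-- The locally convex space `C^∞(M, E)`. -/
def FunctionSpace (E : Type v) [AddCommGroup E] [Module ℝ E] [TopologicalSpace E]
    [IsTopologicalAddGroup E] [ContinuousSMul ℝ E] : Type (max u₁ v) := ↥(smoothFunctions F M E)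

section

variable (E : Type v) [AddCommGroup E] [Module ℝ E] [TopologicalSpace E]
  [IsTopologicalAddGroup E] [ContinuousSMul ℝ E]

noncomputable instance : AddCommGroup (FunctionSpace F M E) :=
  inferInstanceAs (AddCommGroup ↥(smoothFunctions F M E))

noncomputable instance : Module ℝ (FunctionSpace F M E) :=
  inferInstanceAs (Module ℝ ↥(smoothFunctions F M E))

/-- The smooth compact open topology on `C^∞(M, E)`, `M` finite-dimensional: the topology of uniform
convergence on compact sets of all iterated tangent maps `T^k f`, expressed in the charts of `M`. -/
noncomputable instance : TopologicalSpace (FunctionSpace F M E) :=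
  ⨅ e ∈ atlas F M, ⨅ k : ℕ, (tangentCompactOpen k e.target).induced fun f x => f.1 (e.symm x)

end

variable [IsTopologicalAddGroup F] [ContinuousSMul ℝ F]
variable (E : Type v) [AddCommGroup E] [Module ℝ E] [TopologicalSpace E]
  [IsTopologicalAddGroup E] [ContinuousSMul ℝ E] [LocallyConvexSpace ℝ E] [T2Space E]
variable (K : Type u₂) [TopologicalSpace K] [ChartedSpace E K] [Group K] [IsLCLieGroup E K]

instance : IsTopologicalAddGroup (ModelProd E E) := inferInstanceAs (IsTopologicalAddGroup (E × E))

instance : ContinuousSMul ℝ (ModelProd E E) := inferInstanceAs (ContinuousSMul ℝ (E × E))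

/-- The group of smooth maps `M → K` under pointwise multiplication. -/
def smoothMaps : Subgroup (M → K) where
  carrier := {f | Smooth F E f}
  one_mem' := Smooth.const 1
  mul_mem' := fun hf hg => (IsLCLieGroup.smooth_mul (E := E) (G := K)).comp (hf.prodMk hg)
  inv_mem' := fun hf => (IsLCLieGroup.smooth_inv (E := E) (G := K)).comp hf

/-- The group `C^∞(M, K)` (without a topology). -/
def MappingGroup : Type (max u₁ u₂) := ↥(smoothMaps F M E K)

noncomputable instance : Group (MappingGroup F M E K) := inferInstanceAs (Group ↥(smoothMaps F M E K))

end MappingGroup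

/-! ### Lie group structures on a given group -/

/-- A Lie group structure on the group `G`, modelled on `E`. -/
structure LieGroupStructure (E : Type u) [AddCommGroup E] [Module ℝ E] [TopologicalSpace E]
    (G : Type v) [Group G] where
  top : TopologicalSpace G
  charts : ChartedSpace E G
  isLie : IsLCLieGroup E G

namespace LieGroupStructure

variable {E : Type u} [AddCommGroup E] [Module ℝ E] [TopologicalSpace E]
variable {E' : Type w} [AddCommGroup E'] [Module ℝ E'] [TopologicalSpace E']
variable {G : Type v} [Group G]

/-- The group `G`, regarded as a Lie group by means of the structure `S`. -/
def Space (_S : LieGroupStructure E G) : Type v := G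

instance (S : LieGroupStructure E G) : Group S.Space := inferInstanceAs (Group G)

instance (S : LieGroupStructure E G) : TopologicalSpace S.Space := S.top

instance (S : LieGroupStructure E G) : ChartedSpace E S.Space := S.charts

instance (S : LieGroupStructure E G) : IsLCLieGroup E S.Space := S.isLie

/-- The identity of `G`, as a map between the Lie groups given by `S` and `S'`. -/
def idMap (S : LieGroupStructure E G) (S' : LieGroupStructure E' G) : S.Space → S'.Space :=
  fun g => g

/-- `S` and `S'` are the same Lie group structure on `G`: the identity of `G` is a diffeomorphism,
i.e. the topologies agree and the charts of `S` are smoothly compatible with those of `S'`. -/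
def Same (S : LieGroupStructure E G) (S' : LieGroupStructure E' G) : Prop :=
  Smooth E E' (S.idMap S') ∧ Smooth E' E (S'.idMap S)

end LieGroupStructure

section Compatible

variable {F : Type u} [AddCommGroup F] [Module ℝ F] [TopologicalSpace F]
  [IsTopologicalAddGroup F] [ContinuousSMul ℝ F]
variable {M : Type u₁} [TopologicalSpace M] [ChartedSpace F M]
variable {E : Type v} [AddCommGroup E] [Module ℝ E] [TopologicalSpace E]
  [IsTopologicalAddGroup E] [ContinuousSMul ℝ E] [LocallyConvexSpace ℝ E] [T2Space E]
variable {K : Type u₂} [TopologicalSpace K] [ChartedSpace E K] [Group K] [IsLCLieGroup E K]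
variable {E' : Type w} [AddCommGroup E'] [Module ℝ E'] [TopologicalSpace E']

/-- The evaluation `ev_m : C^∞(M,K) → K`, `f ↦ f m`. -/
def evalAt (S : LieGroupStructure E' (MappingGroup F M E K)) (m : M) : S.Space → K :=
  fun f => Subtype.val (p := (· ∈ smoothMaps F M E K)) f m

/-- The Lie group structure `S` on `C^∞(M,K)` is compatible with evaluations: its Lie algebra is
`C^∞(M,𝔨)` with the pointwise bracket (by an isomorphism `θ` of topological Lie algebras), all
evaluations `ev_m` are smooth, and `L(ev_m) = ev_m`. -/
def CompatibleWithEvaluations (S : LieGroupStructure E' (MappingGroup F M E K)) : Prop :=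
  (∀ m, Smooth E' E (evalAt S m)) ∧
  ∃ θ : E' ≃L[ℝ] FunctionSpace F M E,
    (∀ x y m, (θ (lieBracket E' S.Space x y)).1 m = lieBracket E K ((θ x).1 m) ((θ y).1 m)) ∧
    ∀ m x, tangentMapAt E' E (evalAt S m) 1 x = (θ x).1 m

end Compatible

end LCCalculus

/-! By symmetry it suffices that the identity G₁ → G₂ is smooth, and only the regularity of G₂
enters. A point g near 1 in G₁ is joined to 1 by a segment in the chart at 1. The left logarithmic
derivative of this segment is a curve in the Lie algebra of G₁ that depends smoothly on g. Both Lie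
algebras are identified with C^∞(M,𝔨), so the curve can be read in the Lie algebra of G₂ and
integrated there by the evolution map. The resulting curve in G₂ ends at the same element g: under
every ev_m both curves become curves in K that start at 1 and have the same logarithmic derivative,
because L(ev_m) = ev_m on both sides. Such curves coincide (`HasLogDeriv.eq_of_eq`), and the
evaluations separate points. Near 1 the identity is therefore a smooth map into C^∞([0,1], L(G₂))
followed by the smooth time-one evolution. A homomorphism of this form is smooth everywhere, by
translation (`Smooth.of_local_factor`). `IsRegular.smooth_of_separating` is this argument in general
form.

The analytic core is the exponential law `CnOn.curry`: a jointly smooth map of a parameter and of t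
∈ [0,1] is smooth as a map of the parameter into the space of smooth curves. Continuity is a tube
argument applied to all iterated tangent maps (`tendsto_tangentCompactOpen`). Differentiability
requires the difference quotients to converge along with their tangent maps
(`tendsto_diffQuotient`). There the mean value estimate handles order zero, and symmetry of second
derivatives carries the induction. -/

namespace LCCalculus

open Set Filter Topology

universe u v w u₁ u₂ u₃

set_option linter.unusedSectionVars false

/-! ### Directional limits and continuous dependence on a parameter -/

section PartialTangent

variable {X : Type u} [AddCommGroup X] [Module ℝ X] [TopologicalSpace X]
variable {Y : Type v} [AddCommGroup Y] [Module ℝ Y] [TopologicalSpace Y]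
variable {P : Type w} [AddCommGroup P] [Module ℝ P] [TopologicalSpace P]

/-- At every point of `U`, directional derivatives along `U` are limits along proper filters. -/
def AdmitsDirections (U : Set X) : Prop :=
  ∀ x ∈ U, ∀ h, (𝓝[{t : ℝ | t ≠ 0 ∧ x + t • h ∈ U}] (0 : ℝ)).NeBot

theorem AdmitsDirections.prod_univ {U : Set X} (hU : AdmitsDirections U) :
    AdmitsDirections (U ×ˢ (univ : Set P)) := by
  rintro ⟨x, y⟩ ⟨hx, -⟩ ⟨h, k⟩
  simpa using hU x hx h

theorem _root_.IsOpen.admitsDirections [IsTopologicalAddGroup X] [ContinuousSMul ℝ X] {U : Set X}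
    (hU : IsOpen U) : AdmitsDirections U := fun _ hx h => dir_neBot hU hx h

/-- A step of length at most 1/2 away from the nearer end point stays in the interval, so one of the
signs of a small t is always admissible. This makes the one-sided derivatives at the end points
unique. -/
theorem admitsDirections_Icc : AdmitsDirections (Icc (0 : ℝ) 1) := by
  intro x hx h
  rw [← mem_closure_iff_nhdsWithin_neBot, Metric.mem_closure_iff]
  intro ε hε
  obtain ⟨δ, hδ, hδε, hδh⟩ : ∃ δ : ℝ, 0 < δ ∧ δ < ε ∧ δ * |h| ≤ 1 / 2 := by
    have hh : 0 ≤ |h| := abs_nonneg h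
    refine ⟨min (ε / 2) (1 / (2 * (|h| + 1))), by positivity,
      (min_le_left _ _).trans_lt (by linarith), ?_⟩
    calc min (ε / 2) (1 / (2 * (|h| + 1))) * |h| ≤ 1 / (2 * (|h| + 1)) * (|h| + 1) := by
          gcongr
          · exact min_le_right _ _
          · linarith
      _ = 1 / 2 := by field_simp
  have hb := abs_le.1 (show |δ * h| ≤ 1 / 2 by rwa [abs_mul, abs_of_pos hδ])
  rcases le_or_gt x (1 / 2) with hx2 | hx2 <;> rcases le_or_gt 0 h with h0 | h0
  · refine ⟨δ, ⟨hδ.ne', ?_⟩, by simpa [abs_of_pos hδ] using hδε⟩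
    have := mul_nonneg hδ.le h0
    constructor <;> simp only [smul_eq_mul] <;> linarith [hx.1, hb.2]
  · refine ⟨-δ, ⟨neg_ne_zero.2 hδ.ne', ?_⟩, by simpa [abs_of_pos hδ] using hδε⟩
    have := mul_nonpos_of_nonneg_of_nonpos hδ.le h0.le
    constructor <;> simp only [smul_eq_mul, neg_mul] <;> linarith [hx.1, hb.1]
  · refine ⟨-δ, ⟨neg_ne_zero.2 hδ.ne', ?_⟩, by simpa [abs_of_pos hδ] using hδε⟩
    have := mul_nonneg hδ.le h0
    constructor <;> simp only [smul_eq_mul, neg_mul] <;> linarith [hx.2, hb.2]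
  · refine ⟨δ, ⟨hδ.ne', ?_⟩, by simpa [abs_of_pos hδ] using hδε⟩
    have := mul_nonpos_of_nonneg_of_nonpos hδ.le h0.le
    constructor <;> simp only [smul_eq_mul] <;> linarith [hx.2, hb.1]

/-- `dirDeriv` is a `limUnder`, so it carries information only where the limit exists along a proper
filter in a Hausdorff space. -/
theorem HasDirDeriv.dirDeriv_eq [T2Space Y] {f : X → Y} {U : Set X} {x h : X} {y : Y}
    (hf : HasDirDeriv f U x h y) (hU : AdmitsDirections U) (hx : x ∈ U) :
    dirDeriv f U x h = y :=
  have := hU x hx h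
  Tendsto.limUnder_eq hf

theorem HasDirDeriv.unique [T2Space Y] {f : X → Y} {U : Set X} {x h : X} {y y' : Y}
    (hf : HasDirDeriv f U x h y) (hf' : HasDirDeriv f U x h y') (hU : AdmitsDirections U)
    (hx : x ∈ U) : y = y' :=
  have := hU x hx h
  tendsto_nhds_unique hf hf'

theorem HasDirDeriv.prodMk {Z : Type*} [AddCommGroup Z] [Module ℝ Z] [TopologicalSpace Z]
    {f : X → Y} {g : X → Z} {U : Set X} {x h : X} {y : Y} {z : Z}
    (hf : HasDirDeriv f U x h y) (hg : HasDirDeriv g U x h z) :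
    HasDirDeriv (fun x => (f x, g x)) U x h (y, z) :=
  Tendsto.prodMk_nhds hf hg

/-- The derivative of a smooth map is smooth. -/
theorem SmoothOn.exists_deriv [T2Space Y] {f : X → Y} {U : Set X} (hf : SmoothOn f U)
    (hU : AdmitsDirections U) : ∃ df : X × X → Y,
      (∀ x ∈ U, ∀ h, HasDirDeriv f U x h (df (x, h))) ∧ SmoothOn df (U ×ˢ univ) := by
  obtain ⟨-, df, h1, -⟩ := hf 1
  -- The derivative provided by `CnOn (n + 1)` may depend on n; uniqueness of limits identifies each
  -- of them on `U ×ˢ univ` with the one for n = 0.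
  refine ⟨df, h1, fun n => ?_⟩
  obtain ⟨-, df', h1', h2'⟩ := hf (n + 1)
  refine h2'.congr ?_
  rintro ⟨x, h⟩ ⟨hx, -⟩
  exact (h1' x hx h).unique (h1 x hx h) hU hx

/-- Only the variable in X is doubled and the parameter space stays P. The fibrewise tangent map is
thus again a family over P, which permits induction on the order of the tangent map. -/
theorem CnOn.partialTangent {k : ℕ} {Φ : P × X → Y} {Ω : Set (P × X)}
    {D : (P × X) × (P × X) → Y} (hΦ : CnOn k Φ Ω) (hD : CnOn k D (Ω ×ˢ univ)) :
    CnOn k (fun z : P × (X × X) => (Φ (z.1, z.2.1), D ((z.1, z.2.1), (0, z.2.2))))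
      {z | (z.1, z.2.1) ∈ Ω} := by
  let A : P × (X × X) →L[ℝ] P × X := (ContinuousLinearMap.fst ℝ P (X × X)).prod
    ((ContinuousLinearMap.fst ℝ X X).comp (ContinuousLinearMap.snd ℝ P (X × X)))
  let B : P × (X × X) →L[ℝ] P × X := (0 : P × (X × X) →L[ℝ] P).prod
    ((ContinuousLinearMap.snd ℝ X X).comp (ContinuousLinearMap.snd ℝ P (X × X)))
  exact (hΦ.comp_linear A).prodMk
    ((hD.comp_linear (A.prod B)).mono fun z hz => ⟨hz, trivial⟩)

/-- With p fixed, moving in the direction h means moving in the direction (0, h) in P × X. The set U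
need not be open, so [0,1] is covered. -/
theorem tangentMap_eq_partial [T2Space Y] {Φ : P × X → Y} {Ω : Set (P × X)} {U : Set X}
    (hU : AdmitsDirections U) {D : (P × X) × (P × X) → Y}
    (hD : ∀ z ∈ Ω, ∀ h, HasDirDeriv Φ Ω z h (D (z, h))) {p : P} (hp : ∀ x ∈ U, (p, x) ∈ Ω)
    {f : X → Y} (hf : EqOn f (fun x => Φ (p, x)) U) :
    EqOn (tangentMap U f) (fun z => (Φ (p, z.1), D ((p, z.1), (0, z.2)))) (U ×ˢ univ) := by
  rintro ⟨x, h⟩ ⟨hx, -⟩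
  refine Prod.ext (hf hx) (HasDirDeriv.dirDeriv_eq ?_ hU hx)
  have h1 : HasDirDeriv (fun x => Φ (p, x)) U x h (D ((p, x), (0, h))) := by
    have h2 := hD (p, x) (hp x hx) (0, h)
    simp only [HasDirDeriv, Prod.smul_mk, smul_zero, Prod.mk_add_mk, add_zero] at h2 ⊢
    exact h2.mono_left (nhdsWithin_mono _ fun t ht => ⟨ht.1, hp _ ht.2⟩)
  exact h1.congr hx hf.symm

/-- A map that is `C^k` in all variables depends continuously on a parameter, in the topology of
uniform convergence on compact sets of the tangent maps of order `k`. -/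
theorem tendsto_tangentCompactOpen {k : ℕ} : ∀ {X : Type u} [AddCommGroup X] [Module ℝ X]
    [TopologicalSpace X] {Y : Type v} [AddCommGroup Y] [Module ℝ Y] [TopologicalSpace Y]
    [T2Space Y] {Φ : P × X → Y} {Ω : Set (P × X)} {U : Set X} {W : Set P} {f : P → X → Y}
    {p : P}, IsOpen Ω → AdmitsDirections U → W ×ˢ U ⊆ Ω → CnOn k Φ Ω →
    (∀ q ∈ W, EqOn (f q) (fun x => Φ (q, x)) U) → p ∈ W →
    Tendsto f (𝓝[W] p) (@nhds _ (tangentCompactOpen k U) (f p)) := by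
  induction k with
  | zero =>
    intro X _ _ _ Y _ _ _ _ Φ Ω U W f p hΩ hU hW hΦ hf hp
    rw [tangentCompactOpen, TopologicalSpace.tendsto_nhds_generateFrom_iff]
    rintro _ ⟨C, V, hC, hCU, hV, rfl⟩ hfC
    -- Tube lemma: compactness of C makes the neighbourhood of p independent of x.
    have h1 : ∀ᶠ q in 𝓝 p, ∀ x ∈ C, (q, x) ∈ Ω ∧ Φ (q, x) ∈ V := by
      refine hC.eventually_forall_of_forall_eventually
        (P := fun q x => (q, x) ∈ Ω ∧ Φ (q, x) ∈ V) fun x hx => ?_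
      have hpx : (p, x) ∈ Ω := hW ⟨hp, hCU hx⟩
      have hx' : Φ (p, x) ∈ V := by
        have := hfC hx
        rwa [hf p hp (hCU hx)] at this
      exact (show ∀ᶠ z in 𝓝 (p, x), z ∈ Ω from hΩ.mem_nhds hpx).and
        ((ContinuousOn.continuousAt hΦ (hΩ.mem_nhds hpx)).eventually (hV.mem_nhds hx'))
    filter_upwards [self_mem_nhdsWithin, nhdsWithin_le_nhds h1] with q hq hq' x hx
    rw [hf q hq (hCU hx)]
    exact (hq' x hx).2
  | succ k ih =>
    intro X _ _ _ Y _ _ _ _ Φ Ω U W f p hΩ hU hW hΦ hf hp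
    have hΦ' := hΦ.of_succ
    obtain ⟨-, D, hD1, hD2⟩ := hΦ
    rw [tangentCompactOpen, @nhds_induced _ _ (tangentCompactOpen k (U ×ˢ univ)), tendsto_comap_iff]
    refine ih (Ω := {z : P × (X × X) | (z.1, z.2.1) ∈ Ω}) ?_ hU.prod_univ ?_
      (hΦ'.partialTangent hD2) (fun q hq => ?_) hp
    · exact hΩ.preimage (by fun_prop)
    · rintro ⟨q, x, h⟩ ⟨hq, hx, -⟩
      exact hW ⟨hq, hx⟩
    · exact tangentMap_eq_partial hU hD1 (fun x hx => hW ⟨hq, hx⟩) (hf q hq)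

end PartialTangent

/-! ### Symmetry of second derivatives -/

section Symmetry

/-- Equality of the mixed partial derivatives of a function of two real variables. -/
theorem mixed_partials_eq {u ua ub uab uba : ℝ → ℝ → ℝ} {ε : ℝ} (hε : 0 < ε)
    (ha : ∀ a b, |a| < ε → |b| < ε → HasDerivAt (fun s => u s b) (ua a b) a)
    (hb : ∀ a b, |a| < ε → |b| < ε → HasDerivAt (fun s => u a s) (ub a b) b)
    (hab : ∀ a b, |a| < ε → |b| < ε → HasDerivAt (fun s => ua a s) (uab a b) b)
    (hba : ∀ a b, |a| < ε → |b| < ε → HasDerivAt (fun s => ub s b) (uba a b) a)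
    (hcab : ContinuousAt (fun z : ℝ × ℝ => uab z.1 z.2) (0, 0))
    (hcba : ContinuousAt (fun z : ℝ × ℝ => uba z.1 z.2) (0, 0)) : uab 0 0 = uba 0 0 := by
  by_contra hne
  obtain ⟨S, T, hS, hT, hST⟩ := t2_separation_nhds hne
  have h1 := hcab.eventually hS
  have h2 := hcba.eventually hT
  obtain ⟨δ, hδ, hδ'⟩ := Metric.eventually_nhds_iff.1 (h1.and h2)
  obtain ⟨r, hr0, hr⟩ := exists_between (lt_min hε hδ)
  have hrε : r < ε := hr.trans_le (min_le_left _ _)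
  have hrδ : r < δ := hr.trans_le (min_le_right _ _)
  have hlt : ∀ s ∈ Icc 0 r, |s| < ε := fun s hs => by
    rw [abs_of_nonneg hs.1]; exact hs.2.trans_lt hrε
  have hrI : r ∈ Icc 0 r := ⟨hr0.le, le_rfl⟩
  have h0I : (0 : ℝ) ∈ Icc 0 r := ⟨le_rfl, hr0.le⟩
  have hd : ∀ a ∈ Ioo 0 r, ∀ b ∈ Ioo 0 r, uab a b ∈ S ∧ uba a b ∈ T := by
    intro a ha b hb
    refine hδ' (y := (a, b)) ?_
    rw [Prod.dist_eq]
    refine max_lt ?_ ?_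
    · simpa [abs_of_pos ha.1] using ha.2.trans hrδ
    · simpa [abs_of_pos hb.1] using hb.2.trans hrδ
  -- The second difference u(r,r) - u(r,0) - u(0,r) + u(0,0) is evaluated by two mean value theorems
  -- in each order. This gives r² · `uab a b` = r² · `uba a' b'` at two points of the small square,
  -- contradicting the separation by S and T.
  obtain ⟨a, ha', hae⟩ := exists_hasDerivAt_eq_slope (fun s => u s r - u s 0)
    (fun s => ua s r - ua s 0) hr0
    (fun s hs => ((ha s r (hlt s hs) (hlt r hrI)).sub
      (ha s 0 (hlt s hs) (hlt 0 h0I))).continuousAt.continuousWithinAt)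
    (fun s hs => (ha s r (hlt s (Ioo_subset_Icc_self hs)) (hlt r hrI)).sub
      (ha s 0 (hlt s (Ioo_subset_Icc_self hs)) (hlt 0 h0I)))
  have haI := hlt a (Ioo_subset_Icc_self ha')
  obtain ⟨b, hb', hbe⟩ := exists_hasDerivAt_eq_slope (fun s => ua a s) (fun s => uab a s) hr0
    (fun s hs => (hab a s haI (hlt s hs)).continuousAt.continuousWithinAt)
    (fun s hs => hab a s haI (hlt s (Ioo_subset_Icc_self hs)))
  obtain ⟨b', hb'', hbe'⟩ := exists_hasDerivAt_eq_slope (fun s => u r s - u 0 s)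
    (fun s => ub r s - ub 0 s) hr0
    (fun s hs => ((hb r s (hlt r hrI) (hlt s hs)).sub
      (hb 0 s (hlt 0 h0I) (hlt s hs))).continuousAt.continuousWithinAt)
    (fun s hs => (hb r s (hlt r hrI) (hlt s (Ioo_subset_Icc_self hs))).sub
      (hb 0 s (hlt 0 h0I) (hlt s (Ioo_subset_Icc_self hs))))
  have hbI := hlt b' (Ioo_subset_Icc_self hb'')
  obtain ⟨a', ha'', hae'⟩ := exists_hasDerivAt_eq_slope (fun s => ub s b') (fun s => uba s b') hr0
    (fun s hs => (hba s b' (hlt s hs) hbI).continuousAt.continuousWithinAt)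
    (fun s hs => hba s b' (hlt s (Ioo_subset_Icc_self hs)) hbI)
  have heq : uab a b = uba a' b' := by
    rw [hbe, hae', hae, hbe']
    ring
  have m1 := (hd a ha' b hb').1
  have m2 := (hd a' ha'' b' hb'').2
  rw [heq] at m1
  exact hST.le_bot ⟨m1, m2⟩

variable {X : Type u} [AddCommGroup X] [Module ℝ X] [TopologicalSpace X]
  [IsTopologicalAddGroup X] [ContinuousSMul ℝ X]
variable {Y : Type v} [AddCommGroup Y] [Module ℝ Y] [TopologicalSpace Y]

theorem HasDirDeriv.hasDerivAt {f : X → Y} {U : Set X} (hU : IsOpen U) {x h : X} {y : Y} {s : ℝ}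
    (hx : x + s • h ∈ U) (hf : HasDirDeriv f U (x + s • h) h y) (l : Y →L[ℝ] ℝ) :
    HasDerivAt (fun r => l (f (x + r • h))) (l y) s := by
  rw [hasDerivAt_iff_tendsto_slope_zero]
  have h1 : HasDirDeriv f univ (x + s • h) h y :=
    HasDirDeriv.of_inter hU hx (by rwa [univ_inter])
  have h2 := (l.continuous.tendsto _).comp h1
  simpa [Function.comp_def, add_smul, add_assoc, compl_def] using h2

/-- Symmetry of the second derivative. -/
theorem HasDirDeriv.symmetric [IsTopologicalAddGroup Y] [ContinuousSMul ℝ Y]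
    [LocallyConvexSpace ℝ Y] [T2Space Y] {f : X → Y} {U : Set X} (hU : IsOpen U)
    {df : X × X → Y} {ddf : (X × X) × (X × X) → Y}
    (h1 : ∀ x ∈ U, ∀ h, HasDirDeriv f U x h (df (x, h)))
    (h2 : ∀ z ∈ U ×ˢ (univ : Set X), ∀ k, HasDirDeriv df (U ×ˢ univ) z k (ddf (z, k)))
    (hc : ContinuousOn ddf ((U ×ˢ (univ : Set X)) ×ˢ univ)) {x : X} (hx : x ∈ U) (h k : X) :
    ddf ((x, h), (k, 0)) = ddf ((x, k), (h, 0)) := by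
  by_contra hne
  -- A functional separating the two values reduces the claim to the real function (a, b) ↦ l (f (x
  -- + a • h + b • k)).
  obtain ⟨l, hl⟩ := geometric_hahn_banach_point_point hne
  refine hl.ne ?_
  have hcont : Continuous fun z : ℝ × ℝ => x + z.1 • h + z.2 • k := by fun_prop
  have hmem : (fun z : ℝ × ℝ => x + z.1 • h + z.2 • k) ⁻¹' U ∈ 𝓝 ((0 : ℝ), (0 : ℝ)) :=
    hcont.continuousAt (hU.mem_nhds (by simpa using hx))
  obtain ⟨ε, hε, hεU⟩ := Metric.mem_nhds_iff.1 hmem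
  have hUε : ∀ a b : ℝ, |a| < ε → |b| < ε → x + a • h + b • k ∈ U := by
    intro a b ha hb
    refine hεU (?_ : (a, b) ∈ _)
    rw [Metric.mem_ball, Prod.dist_eq]
    simpa using ⟨ha, hb⟩
  have hUU : IsOpen (U ×ˢ (univ : Set X)) := hU.prod isOpen_univ
  have hUUU : IsOpen ((U ×ˢ (univ : Set X)) ×ˢ (univ : Set (X × X))) := hUU.prod isOpen_univ
  have hctn : ∀ j i : X, ContinuousAt
      (fun z : ℝ × ℝ => l (ddf ((x + z.1 • h + z.2 • k, j), (i, 0)))) (0, 0) := by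
    intro j i
    refine l.continuous.continuousAt.comp ?_
    refine ContinuousAt.comp (f := fun z : ℝ × ℝ => ((x + z.1 • h + z.2 • k, j), (i, (0 : X))))
      (hc.continuousAt (hUUU.mem_nhds ⟨⟨?_, trivial⟩, trivial⟩)) ?_
    · simpa using hx
    · exact Continuous.continuousAt (by fun_prop)
  have key := mixed_partials_eq (u := fun a b => l (f (x + a • h + b • k)))
    (ua := fun a b => l (df (x + a • h + b • k, h)))
    (ub := fun a b => l (df (x + a • h + b • k, k)))
    (uab := fun a b => l (ddf ((x + a • h + b • k, h), (k, 0))))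
    (uba := fun a b => l (ddf ((x + a • h + b • k, k), (h, 0)))) hε
    (fun a b ha hb => ?_) (fun a b ha hb => ?_) (fun a b ha hb => ?_) (fun a b ha hb => ?_)
    (hctn h k) (hctn k h)
  · simpa using key
  · have hm := hUε a b ha hb
    rw [add_right_comm] at hm ⊢
    have := HasDirDeriv.hasDerivAt hU hm (h1 _ hm h) l
    simpa only [add_right_comm] using this
  · have hm := hUε a b ha hb
    exact HasDirDeriv.hasDerivAt hU hm (h1 _ hm k) l
  · have hm := hUε a b ha hb
    have := HasDirDeriv.hasDerivAt (x := (x + a • h, h)) (h := (k, (0 : X))) (s := b) hUU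
      (by simpa using hm) (h2 _ (by simpa using hm) _) l
    simpa using this
  · have hm := hUε a b ha hb
    rw [add_right_comm] at hm
    have := HasDirDeriv.hasDerivAt (x := (x + b • k, k)) (h := (h, (0 : X))) (s := a) hUU
      (by simpa using hm) (h2 _ (by simpa using hm) _) l
    simpa [add_right_comm] using this

end Symmetry

/-! ### Convergence of difference quotients with all tangent maps -/

section DifferenceQuotients

variable {P : Type w} [AddCommGroup P] [Module ℝ P] [TopologicalSpace P]
  [IsTopologicalAddGroup P] [ContinuousSMul ℝ P]

/-- The difference quotients of a `C^(k+1)`-map with respect to a parameter converge uniformly on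
compact sets together with their tangent maps of order `k`. -/
theorem tendsto_diffQuotient {k : ℕ} : ∀ {X : Type u} [AddCommGroup X] [Module ℝ X]
    [TopologicalSpace X] [IsTopologicalAddGroup X] [ContinuousSMul ℝ X]
    {Y : Type v} [AddCommGroup Y] [Module ℝ Y] [TopologicalSpace Y]
    [IsTopologicalAddGroup Y] [ContinuousSMul ℝ Y] [LocallyConvexSpace ℝ Y] [T2Space Y]
    {Φ : P × X → Y} {Ω : Set (P × X)} {U : Set X} {W : Set P} {f : ℝ → X → Y} {g : X → Y}
    {p q : P}, IsOpen Ω → AdmitsDirections U → W ×ˢ U ⊆ Ω → CnOn (k + 1) Φ Ω →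
    (∀ t : ℝ, t ≠ 0 → p + t • q ∈ W →
      EqOn (f t) (fun x => t⁻¹ • (Φ (p + t • q, x) - Φ (p, x))) U) →
    (∀ x ∈ U, HasDirDeriv Φ Ω (p, x) (q, 0) (g x)) → p ∈ W →
    Tendsto f (𝓝[{t : ℝ | t ≠ 0 ∧ p + t • q ∈ W}] 0) (@nhds _ (tangentCompactOpen k U) g) := by
  induction k with
  | zero =>
    intro X _ _ _ _ _ Y _ _ _ _ _ _ _ Φ Ω U W f g p q hΩ hU hW hΦ hf hg hp
    obtain ⟨-, D, hD1, hD2⟩ := hΦ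
    rw [tangentCompactOpen, TopologicalSpace.tendsto_nhds_generateFrom_iff]
    rintro _ ⟨C, V, hC, hCU, hV, rfl⟩ hgC
    have h1 : ∀ᶠ t in 𝓝 (0 : ℝ), ∀ x ∈ C, t ≠ 0 →
        t⁻¹ • (Φ (p + t • q, x) - Φ (p, x)) ∈ V := by
      refine hC.eventually_forall_of_forall_eventually
        (P := fun t x => t ≠ 0 → t⁻¹ • (Φ (p + t • q, x) - Φ (p, x)) ∈ V) fun x hx => ?_
      have hpx : (p, x) ∈ Ω := hW ⟨hp, hCU hx⟩
      have hgx : g x = D ((p, x), (q, 0)) :=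
        (hg x (hCU hx)).unique (hD1 _ hpx _) hΩ.admitsDirections hpx
      have hxV : V ∈ 𝓝 (D ((p, x), (q, 0))) := hgx ▸ hV.mem_nhds (hgC hx)
      -- V is shrunk to a closed convex neighbourhood: once the derivative in the direction (q, 0)
      -- lies in it along a segment, so does the difference quotient, by `segment_mem`.
      obtain ⟨V₁, ⟨hV₁, hV₁c⟩, hV₁V⟩ := (closed_nhds_basis _).mem_iff.1 hxV
      obtain ⟨N, ⟨hN, hNc⟩, hNV⟩ :=
        (LocallyConvexSpace.convex_basis (𝕜 := ℝ) (D ((p, x), (q, 0)))).mem_iff.1 hV₁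
      have hcl : closure N ⊆ V := (closure_minimal hNV hV₁c).trans hV₁V
      have hΩΩ : IsOpen (Ω ×ˢ (univ : Set (P × X))) := hΩ.prod isOpen_univ
      have hA : {z : (P × X) × (P × X) | z.1 ∈ Ω ∧ D z ∈ closure N} ∈ 𝓝 ((p, x), (q, (0 : X))) :=
        inter_mem (continuous_fst.continuousAt (hΩ.mem_nhds hpx))
          ((ContinuousOn.continuousAt hD2 (hΩΩ.mem_nhds ⟨hpx, trivial⟩))
            (mem_of_superset hN subset_closure))
      have hcont : Continuous fun z : ℝ × X => ((p + z.1 • q, z.2), (q, (0 : X))) := by fun_prop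
      have hB : (fun z : ℝ × X => ((p + z.1 • q, z.2), (q, (0 : X)))) ⁻¹'
          {z : (P × X) × (P × X) | z.1 ∈ Ω ∧ D z ∈ closure N} ∈ 𝓝 ((0 : ℝ), x) :=
        hcont.continuousAt (by simpa using hA)
      rw [nhds_prod_eq, mem_prod_iff] at hB
      obtain ⟨R, hR, B, hB, hRB⟩ := hB
      obtain ⟨ε, hε, hεR⟩ := Metric.mem_nhds_iff.1 hR
      rw [nhds_prod_eq]
      refine mem_of_superset (prod_mem_prod (Metric.ball_mem_nhds (0 : ℝ) hε) hB) ?_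
      rintro ⟨t, x'⟩ ⟨ht, hx'⟩ ht0
      refine hcl ?_
      have := segment_mem hΩ hD1 hNc.closure isClosed_closure (y := (p, x')) (k := (q, 0)) ht0
        fun s hs => ?_
      · simpa using this
      · have hst : s * t ∈ R := by
          apply hεR
          simp only [mem_ball_zero_iff, Real.norm_eq_abs] at ht ⊢
          rw [abs_mul, abs_of_nonneg hs.1]
          exact (mul_le_of_le_one_left (abs_nonneg t) hs.2).trans_lt ht
        simpa using hRB (mk_mem_prod hst hx')
    filter_upwards [self_mem_nhdsWithin, nhdsWithin_le_nhds h1] with t ht ht' x hx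
    rw [hf t ht.1 ht.2 (hCU hx)]
    exact ht' x hx ht.1
  | succ k ih =>
    intro X _ _ _ _ _ Y _ _ _ _ _ _ _ Φ Ω U W f g p q hΩ hU hW hΦ hf hg hp
    have hΦ' := hΦ.of_succ
    obtain ⟨-, D, hD1, hD2⟩ := hΦ
    have hD2' := hD2
    obtain ⟨-, DD, hDD1, hDD2⟩ := hD2'
    rw [tangentCompactOpen, @nhds_induced _ _ (tangentCompactOpen k (U ×ˢ univ)), tendsto_comap_iff]
    have hpU : ∀ x ∈ U, (p, x) ∈ Ω := fun x hx => hW ⟨hp, hx⟩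
    -- The tangent map of a difference quotient of Φ is the difference quotient of the partial
    -- tangent map, so the induction hypothesis is applied to the latter.
    refine ih (Ω := {z : P × (X × X) | (z.1, z.2.1) ∈ Ω}) (W := W)
      (Φ := fun z : P × (X × X) => (Φ (z.1, z.2.1), D ((z.1, z.2.1), (0, z.2.2)))) ?_ hU.prod_univ
      ?_ (hΦ'.partialTangent hD2) (fun t ht htW => ?_) ?_ hp
    · exact hΩ.preimage (by fun_prop)
    · rintro ⟨q, x, h⟩ ⟨hq, hx, -⟩
      exact hW ⟨hq, hx⟩
    · have htU : ∀ x ∈ U, (p + t • q, x) ∈ Ω := fun x hx => hW ⟨htW, hx⟩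
      rintro ⟨x, h⟩ ⟨hx, -⟩
      refine Prod.ext (hf t ht htW hx) ?_
      refine HasDirDeriv.dirDeriv_eq ?_ hU hx
      have hder : ∀ p' : P, (∀ x ∈ U, (p', x) ∈ Ω) →
          HasDirDeriv (fun x => Φ (p', x)) U x h (D ((p', x), (0, h))) := by
        intro p' hp'
        have h2 := hD1 (p', x) (hp' x hx) (0, h)
        simp only [HasDirDeriv, Prod.smul_mk, smul_zero, Prod.mk_add_mk, add_zero] at h2 ⊢
        exact h2.mono_left (nhdsWithin_mono _ fun t ht => ⟨ht.1, hp' _ ht.2⟩)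
      refine HasDirDeriv.congr ?_ hx (hf t ht htW).symm
      have h3 := ((hder _ htU).sub (hder _ hpU)).const_smul t⁻¹
      refine h3.congr fun r => ?_
      simp only [smul_sub, smul_comm t⁻¹ r⁻¹]
      abel
    · rintro ⟨x, h⟩ ⟨hx, -⟩
      have hpx := hpU x hx
      refine HasDirDeriv.prodMk ?_ ?_
      · simpa [HasDirDeriv] using hg x hx
      · have e2 : dirDeriv g U x h = DD (((p, x), (q, 0)), ((0, h), 0)) := by
          refine HasDirDeriv.dirDeriv_eq ?_ hU hx
          have h4 := hDD1 ((p, x), (q, 0)) ⟨hpx, trivial⟩ ((0, h), 0)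
          have h5 : HasDirDeriv (fun x => D ((p, x), (q, 0))) U x h
              (DD (((p, x), (q, 0)), ((0, h), 0))) := by
            simp only [HasDirDeriv, Prod.smul_mk, smul_zero, Prod.mk_add_mk, add_zero] at h4 ⊢
            exact h4.mono_left (nhdsWithin_mono _ fun t ht => ⟨ht.1, hpU _ ht.2, trivial⟩)
          refine h5.congr hx fun x' hx' => ?_
          exact ((hg x' hx').unique (hD1 _ (hpU _ hx') _) hΩ.admitsDirections (hpU _ hx')).symm
        -- The derivative of g in x differentiates first along q and then along h; the induction
        -- hypothesis wants the opposite order.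
        change HasDirDeriv _ _ _ _ (dirDeriv g U x h)
        rw [e2, ← HasDirDeriv.symmetric hΩ hD1 hDD1 hDD2.continuousOn hpx (0, h) (q, 0)]
        have h6 := hDD1 ((p, x), (0, h)) ⟨hpx, trivial⟩ ((q, 0), 0)
        simpa [HasDirDeriv] using h6

end DifferenceQuotients

/-! ### The smooth compact open topology is a vector space topology -/

section VectorTopology

/-- A space of functions that is linear on `U` and consists of `C^k`-maps is a topological vector
space for the topology induced by the tangent maps of order `k`. -/
theorem tangentCompactOpen_induced {S : Type w} [AddCommGroup S] [Module ℝ S] {k : ℕ} :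
    ∀ {X : Type u} [AddCommGroup X] [Module ℝ X] [TopologicalSpace X]
    {Y : Type v} [AddCommGroup Y] [Module ℝ Y] [TopologicalSpace Y]
    [IsTopologicalAddGroup Y] [ContinuousSMul ℝ Y] [T2Space Y] {U : Set X} {ι : S → X → Y},
    AdmitsDirections U → (∀ s, CnOn k (ι s) U) →
    (∀ a b, EqOn (ι (a + b)) (fun x => ι a x + ι b x) U) →
    (∀ (c : ℝ) a, EqOn (ι (c • a)) (fun x => c • ι a x) U) →
    @IsTopologicalAddGroup S ((tangentCompactOpen k U).induced ι) _ ∧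
      @ContinuousSMul ℝ S _ _ ((tangentCompactOpen k U).induced ι) := by
  induction k with
  | zero =>
    intro X _ _ _ Y _ _ _ _ _ _ U ι hU hι hadd hsmul
    -- At order zero, restriction to U is a linear map into C(U, Y) that induces the topology, so
    -- both properties are pulled back from the compact open topology.
    let J : S →ₗ[ℝ] C(U, Y) :=
      { toFun := fun s => ⟨U.domRestrict (ι s), ContinuousOn.domRestrict (hι s)⟩
        map_add' := fun a b => by ext x; exact hadd a b x.2
        map_smul' := fun c a => by ext x; exact hsmul c a x.2 }
    have hJ : (tangentCompactOpen 0 U).induced ι = ContinuousMap.compactOpen.induced J := by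
      rw [tangentCompactOpen, ContinuousMap.compactOpen, induced_generateFrom_eq,
        induced_generateFrom_eq]
      congr 1
      ext s
      constructor
      · rintro ⟨_, ⟨C, V, hC, hCU, hV, rfl⟩, rfl⟩
        refine ⟨_, ⟨Subtype.val ⁻¹' C, ?_, V, hV, rfl⟩, ?_⟩
        · exact Topology.IsInducing.subtypeVal.isCompact_preimage' hC (by simpa using hCU)
        · ext a
          exact ⟨fun h x hx => h (x := ⟨x, hCU hx⟩) hx, fun h x hx => h hx⟩
      · rintro ⟨_, ⟨C, hC, V, hV, rfl⟩, rfl⟩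
        refine ⟨_, ⟨Subtype.val '' C, V, hC.image continuous_subtype_val, ?_, hV, rfl⟩, ?_⟩
        · rintro _ ⟨x, -, rfl⟩
          exact x.2
        · ext a
          exact ⟨fun h x hx => h ⟨x, hx, rfl⟩, by rintro h _ ⟨x, hx, rfl⟩; exact h hx⟩
    rw [hJ]
    exact ⟨topologicalAddGroup_induced J, continuousSMul_induced J⟩
  | succ k ih =>
    intro X _ _ _ Y _ _ _ _ _ _ U ι hU hι hadd hsmul
    rw [tangentCompactOpen, induced_compose]
    have hι' : ∀ s, ∃ df : X × X → Y, (∀ x ∈ U, ∀ h, HasDirDeriv (ι s) U x h (df (x, h))) ∧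
        CnOn k df (U ×ˢ univ) := fun s => (hι s).2
    choose df h1 h2 using hι'
    have heq : ∀ s, EqOn (fun z : X × X => (ι s z.1, df s z)) (tangentMap U (ι s))
        (U ×ˢ univ) := by
      rintro s ⟨x, h⟩ ⟨hx, -⟩
      exact Prod.ext rfl ((h1 s x hx h).dirDeriv_eq hU hx).symm
    -- On `U ×ˢ univ` the tangent maps of the `ι s` are C^k and again linear in s.
    refine ih hU.prod_univ (fun s => ?_) (fun a b => ?_) (fun c a => ?_)
    · refine CnOn.congr (CnOn.prodMk ?_ (h2 s)) (heq s)
      exact ((hι s).of_succ.comp_linear (ContinuousLinearMap.fst ℝ X X)).mono fun z hz => hz.1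
    · rintro ⟨x, h⟩ ⟨hx, -⟩
      refine Prod.ext (hadd a b hx) (HasDirDeriv.dirDeriv_eq ?_ hU hx)
      have ea : dirDeriv (ι a) U x h = _ := (h1 a x hx h).dirDeriv_eq hU hx
      have eb : dirDeriv (ι b) U x h = _ := (h1 b x hx h).dirDeriv_eq hU hx
      simp only [Function.comp_apply, tangentMap, Prod.mk_add_mk, ea, eb]
      refine HasDirDeriv.congr (f := fun x => ι a x + ι b x) ?_ hx (hadd a b).symm
      refine ((h1 a x hx h).add (h1 b x hx h)).congr fun t => ?_
      rw [← smul_add, add_sub_add_comm]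
    · rintro ⟨x, h⟩ ⟨hx, -⟩
      refine Prod.ext (hsmul c a hx) (HasDirDeriv.dirDeriv_eq ?_ hU hx)
      have ea : dirDeriv (ι a) U x h = _ := (h1 a x hx h).dirDeriv_eq hU hx
      simp only [Function.comp_apply, tangentMap, Prod.smul_mk, ea]
      refine HasDirDeriv.congr (f := fun x => c • ι a x) ?_ hx (hsmul c a).symm
      refine ((h1 a x hx h).const_smul c).congr fun t => ?_
      rw [← smul_sub, smul_comm]

variable {E : Type u} [AddCommGroup E] [Module ℝ E] [TopologicalSpace E]
  [IsTopologicalAddGroup E] [ContinuousSMul ℝ E]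

theorem extendPath_apply {G : Type*} (γ : unitInterval → G) (t : unitInterval) :
    extendPath γ t = γ t :=
  IccExtend_val _ _ _

theorem PathSpace.tangentCompactOpen_induced [T2Space E] (k : ℕ) :
    @IsTopologicalAddGroup (PathSpace E)
      ((tangentCompactOpen k (Icc (0 : ℝ) 1)).induced fun ξ => extendPath ξ.1) _ ∧
    @ContinuousSMul ℝ (PathSpace E) _ _
      ((tangentCompactOpen k (Icc (0 : ℝ) 1)).induced fun ξ => extendPath ξ.1) :=
  LCCalculus.tangentCompactOpen_induced admitsDirections_Icc (fun ξ => ξ.2 k)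
    (fun _ _ _ _ => rfl) (fun _ _ _ _ => rfl)

/-- The chain rule `CnOn.comp` asks for a topological vector space in the middle; this instance and
the next one allow C^∞([0,1], E) in that place. -/
instance [T2Space E] : IsTopologicalAddGroup (PathSpace E) :=
  topologicalAddGroup_iInf fun k => (PathSpace.tangentCompactOpen_induced k).1

instance [T2Space E] : ContinuousSMul ℝ (PathSpace E) :=
  continuousSMul_iInf fun k => (PathSpace.tangentCompactOpen_induced k).2

/-- The topology is an infimum of induced ones, so convergence can be tested separately at each
order k. -/
theorem PathSpace.tendsto_nhds_iff {α : Type*} {l : Filter α} {f : α → PathSpace E}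
    {ξ : PathSpace E} : Tendsto f l (𝓝 ξ) ↔ ∀ k : ℕ, Tendsto (fun a => extendPath (f a).1) l
      (@nhds _ (tangentCompactOpen k (Icc (0 : ℝ) 1)) (extendPath ξ.1)) := by
  have h1 : 𝓝 ξ = ⨅ k : ℕ, comap (fun ξ : PathSpace E => extendPath ξ.1)
      (@nhds _ (tangentCompactOpen k (Icc (0 : ℝ) 1)) (extendPath ξ.1)) := by
    refine (nhds_iInf (a := ξ)).trans (iInf_congr fun k => ?_)
    exact @nhds_induced _ _ (tangentCompactOpen k (Icc (0 : ℝ) 1)) _ _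
  simp only [h1, tendsto_iInf, tendsto_comap_iff, Function.comp_def]

/-- A function that is smooth on `[0,1]`, as an element of `C^∞([0,1], E)`. -/
noncomputable def PathSpace.mk (f : ℝ → E) (hf : SmoothOn f (Icc 0 1)) : PathSpace E :=
  ⟨fun t => f t, fun n => (hf n).congr fun t ht =>
    (extendPath_apply (fun t : unitInterval => f t) ⟨t, ht⟩).symm⟩

theorem PathSpace.mk_apply (f : ℝ → E) (hf : SmoothOn f (Icc 0 1)) (t : unitInterval) :
    (PathSpace.mk f hf).1 t = f t := rfl

end VectorTopology

/-! ### The exponential law -/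

section ExponentialLaw

variable {E : Type v} [AddCommGroup E] [Module ℝ E] [TopologicalSpace E]
  [IsTopologicalAddGroup E] [ContinuousSMul ℝ E] [LocallyConvexSpace ℝ E] [T2Space E]

theorem CnOn.continuousLinearMap {Y : Type v} [AddCommGroup Y] [Module ℝ Y] [TopologicalSpace Y]
    {n : ℕ} : ∀ {X : Type u} [AddCommGroup X] [Module ℝ X] [TopologicalSpace X] (L : X →L[ℝ] Y)
    (U : Set X), CnOn n (fun x => L x) U := by
  induction n with
  | zero => intro X _ _ _ L U; exact L.continuous.continuousOn
  | succ n ih =>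
    intro X _ _ _ L U
    refine ⟨L.continuous.continuousOn, fun z => L z.2, fun x _ h => ?_,
      ih (L.comp (ContinuousLinearMap.snd ℝ X X)) _⟩
    refine tendsto_const_nhds.congr' ?_
    filter_upwards [self_mem_nhdsWithin] with t ht
    rw [map_add, map_smul, add_sub_cancel_left, inv_smul_smul₀ ht.1]

theorem SmoothOn.partial_snd {P : Type w} [AddCommGroup P] [Module ℝ P] [TopologicalSpace P]
    [IsTopologicalAddGroup P] [ContinuousSMul ℝ P] {Φ : P × ℝ → E} {Ω : Set (P × ℝ)}
    (hΩ : IsOpen Ω) (hΦ : SmoothOn Φ Ω) {I : Set ℝ} {p : P} (hp : ∀ t ∈ I, (p, t) ∈ Ω) :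
    SmoothOn (fun t => Φ (p, t)) I := by
  intro n
  refine CnOn.comp hΩ (hΦ n) ((CnOn.const p I).prodMk ?_) hp
  exact CnOn.continuousLinearMap (ContinuousLinearMap.id ℝ ℝ) I

/-- The exponential law: a smooth map of a parameter and of `t ∈ [0,1]` is a smooth map of the
parameter with values in `C^∞([0,1], E)`. -/
theorem CnOn.curry {n : ℕ} : ∀ {P : Type w} [AddCommGroup P] [Module ℝ P] [TopologicalSpace P]
    [IsTopologicalAddGroup P] [ContinuousSMul ℝ P] {Φ : P × ℝ → E} {Ω : Set (P × ℝ)} {W : Set P}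
    {f : P → PathSpace E}, IsOpen Ω → W ×ˢ Icc (0 : ℝ) 1 ⊆ Ω → SmoothOn Φ Ω →
    (∀ p ∈ W, ∀ t : unitInterval, (f p).1 t = Φ (p, t)) → CnOn n f W := by
  have hext : ∀ {P : Type w} [AddCommGroup P] [Module ℝ P] [TopologicalSpace P]
      {Φ : P × ℝ → E} {W : Set P} {f : P → PathSpace E},
      (∀ p ∈ W, ∀ t : unitInterval, (f p).1 t = Φ (p, t)) →
      ∀ p ∈ W, EqOn (extendPath (f p).1) (fun t => Φ (p, t)) (Icc 0 1) := by
    intro P _ _ _ Φ W f hf p hp t ht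
    exact (extendPath_apply _ ⟨t, ht⟩).trans (hf p hp ⟨t, ht⟩)
  have hcont : ∀ {P : Type w} [AddCommGroup P] [Module ℝ P] [TopologicalSpace P]
      {Φ : P × ℝ → E} {Ω : Set (P × ℝ)} {W : Set P} {f : P → PathSpace E}, IsOpen Ω →
      W ×ˢ Icc (0 : ℝ) 1 ⊆ Ω → SmoothOn Φ Ω →
      (∀ p ∈ W, ∀ t : unitInterval, (f p).1 t = Φ (p, t)) → ContinuousOn f W := by
    intro P _ _ _ Φ Ω W f hΩ hW hΦ hf p hp
    exact PathSpace.tendsto_nhds_iff.2 fun k => tendsto_tangentCompactOpen hΩ admitsDirections_Icc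
      hW (hΦ k) (hext hf) hp
  induction n with
  | zero => intro P _ _ _ _ _ Φ Ω W f hΩ hW hΦ hf; exact hcont hΩ hW hΦ hf
  | succ n ih =>
    intro P _ _ _ _ _ Φ Ω W f hΩ hW hΦ hf
    obtain ⟨D, hD1, hD2⟩ := hΦ.exists_deriv hΩ.admitsDirections
    -- For a parameter p, a direction q and a time t, A gives the point (p, t) and B the tangent
    -- vector (q, 0): time is not varied.
    let A : (P × P) × ℝ →L[ℝ] P × ℝ :=
      ((ContinuousLinearMap.fst ℝ P P).comp (ContinuousLinearMap.fst ℝ (P × P) ℝ)).prod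
        (ContinuousLinearMap.snd ℝ (P × P) ℝ)
    let B : (P × P) × ℝ →L[ℝ] P × ℝ :=
      ((ContinuousLinearMap.snd ℝ P P).comp (ContinuousLinearMap.fst ℝ (P × P) ℝ)).prod 0
    have hΦ' : SmoothOn (fun z : (P × P) × ℝ => D ((z.1.1, z.2), (z.1.2, 0))) (A ⁻¹' Ω) :=
      fun n => ((hD2 n).comp_linear (A.prod B)).mono fun z hz => ⟨hz, trivial⟩
    have hΩ' : IsOpen (A ⁻¹' Ω) := hΩ.preimage A.continuous
    have hsub : (W ×ˢ (univ : Set P)) ×ˢ Icc (0 : ℝ) 1 ⊆ A ⁻¹' Ω :=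
      fun z hz => hW ⟨hz.1.1, hz.2⟩
    have hsm : ∀ z : P × P, z.1 ∈ W → SmoothOn (fun t => D ((z.1, t), (z.2, 0))) (Icc 0 1) :=
      fun z hz => hΦ'.partial_snd hΩ' fun t ht => hsub ⟨⟨hz, trivial⟩, ht⟩
    classical
    -- The candidate derivative at p along q is the path t ↦ D((p, t), (q, 0)). It is again a family
    -- given by a jointly smooth map, now with parameters in P × P. The value 0 off W plays no role.
    let df : P × P → PathSpace E := fun z => if hz : z.1 ∈ W then PathSpace.mk _ (hsm z hz) else 0
    have hdf : ∀ z ∈ W ×ˢ (univ : Set P), ∀ t : unitInterval,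
        (df z).1 t = D ((z.1, t), (z.2, 0)) := by
      intro z hz t
      simp only [df, hz.1, dif_pos]
      exact PathSpace.mk_apply _ (hsm z hz.1) t
    refine ⟨hcont hΩ hW hΦ hf, df, fun p hp q => ?_, ih hΩ' hsub hΦ' hdf⟩
    refine PathSpace.tendsto_nhds_iff.2 fun k => ?_
    -- Order k of the path topology uses k + 1 derivatives of Φ, so even a C^1 conclusion needs Φ to
    -- be smooth.
    refine tendsto_diffQuotient hΩ admitsDirections_Icc hW (hΦ (k + 1)) (fun t _ htW s hs => ?_)
      (fun s hs => ?_) hp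
    · have h1 := hext hf _ htW hs
      have h2 := hext hf _ hp hs
      exact congrArg₂ (fun a b => t⁻¹ • (a - b)) h1 h2
    · rw [show extendPath (df (p, q)).1 s = D ((p, s), (q, 0)) from
        (extendPath_apply _ ⟨s, hs⟩).trans (hdf (p, q) ⟨hp, trivial⟩ ⟨s, hs⟩)]
      exact hD1 _ (hW ⟨hp, hs⟩) _

end ExponentialLaw

/-! ### Further rules of calculus -/

section Calculus

variable {X : Type u} [AddCommGroup X] [Module ℝ X] [TopologicalSpace X]
variable {Y : Type v} [AddCommGroup Y] [Module ℝ Y] [TopologicalSpace Y]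

theorem SmoothOn.hasDirDeriv [T2Space Y] {f : X → Y} {U : Set X} (hf : SmoothOn f U)
    (hU : AdmitsDirections U) {x : X} (hx : x ∈ U) (h : X) :
    HasDirDeriv f U x h (dirDeriv f U x h) := by
  obtain ⟨df, h1, -⟩ := hf.exists_deriv hU
  rw [(h1 x hx h).dirDeriv_eq hU hx]
  exact h1 x hx h

theorem SmoothOn.dirDeriv [T2Space Y] {f : X → Y} {U : Set X} (hf : SmoothOn f U)
    (hU : AdmitsDirections U) :
    SmoothOn (fun z : X × X => LCCalculus.dirDeriv f U z.1 z.2) (U ×ˢ univ) := by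
  obtain ⟨df, h1, h2⟩ := hf.exists_deriv hU
  exact fun n => (h2 n).congr fun z hz => ((h1 z.1 hz.1 z.2).dirDeriv_eq hU hz.1).symm

theorem AdmitsDirections.inter_isOpen [IsTopologicalAddGroup X] [ContinuousSMul ℝ X] {U V : Set X}
    (hU : AdmitsDirections U) (hV : IsOpen V) : AdmitsDirections (U ∩ V) := by
  rintro x ⟨hxU, hxV⟩ h
  have hc : Continuous fun t : ℝ => x + t • h := by fun_prop
  have hmem : (fun t : ℝ => x + t • h) ⁻¹' V ∈ 𝓝 (0 : ℝ) :=
    hc.continuousAt (hV.mem_nhds (by simpa using hxV))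
  have h2 : {t : ℝ | t ≠ 0 ∧ x + t • h ∈ U ∩ V} =
      {t : ℝ | t ≠ 0 ∧ x + t • h ∈ U} ∩ (fun t : ℝ => x + t • h) ⁻¹' V := by
    ext t; simp [and_assoc]
  rw [h2, nhdsWithin_inter_of_mem' (nhdsWithin_le_nhds hmem)]
  exact hU x hxU h

/-- The product of a scalar function with a vector valued function. -/
theorem CnOn.smul [IsTopologicalAddGroup Y] [ContinuousSMul ℝ Y] {n : ℕ} :
    ∀ {X : Type u} [AddCommGroup X] [Module ℝ X] [TopologicalSpace X] {a : X → ℝ} {b : X → Y}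
    {U : Set X}, CnOn n a U → CnOn n b U → CnOn n (fun x => a x • b x) U := by
  induction n with
  | zero => intro X _ _ _ a b U ha hb; exact ContinuousOn.smul ha hb
  | succ n ih =>
    intro X _ _ _ a b U ha hb
    have ha' := ha.of_succ
    have hb' := hb.of_succ
    obtain ⟨hac, da, ha1, ha2⟩ := ha
    obtain ⟨hbc, db, hb1, hb2⟩ := hb
    have ha3 : CnOn n (fun z : X × X => a z.1) (U ×ˢ univ) :=
      (ha'.comp_linear (ContinuousLinearMap.fst ℝ X X)).mono fun z hz => hz.1
    have hb3 : CnOn n (fun z : X × X => b z.1) (U ×ˢ univ) :=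
      (hb'.comp_linear (ContinuousLinearMap.fst ℝ X X)).mono fun z hz => hz.1
    refine ⟨hac.smul hbc, fun z => da z • b z.1 + a z.1 • db z, fun x hx h => ?_, ?_⟩
    · have h0 : Tendsto (fun t : ℝ => t) (𝓝[{t : ℝ | t ≠ 0 ∧ x + t • h ∈ U}] 0) (𝓝 0) :=
        tendsto_id.mono_left nhdsWithin_le_nhds
      -- Writing b(x + t h) as b x plus t times its difference quotient gives b(x + t h) → b x; the
      -- product rule needs this.
      have hb0 := (h0.smul (hb1 x hx h)).add_const (b x)
      rw [zero_smul, zero_add] at hb0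
      refine (((ha1 x hx h).smul hb0).add ((hb1 x hx h).const_smul (a x))).congr' ?_
      filter_upwards [self_mem_nhdsWithin] with t ht
      rw [smul_inv_smul₀ ht.1, sub_add_cancel, smul_eq_mul, mul_smul, smul_comm (a x) t⁻¹,
        ← smul_add, sub_smul, smul_sub]
      congr 1
      abel
    · exact CnOn.linear_comp (ContinuousLinearMap.fst ℝ Y Y + ContinuousLinearMap.snd ℝ Y Y)
        ((ih ha2 hb3).prodMk (ih ha3 hb2))

/-- Functionals turn vector-valued curves into real functions, to which the classical mean value
inequality applies. -/
theorem HasDirDeriv.hasDerivWithinAt {f : ℝ → Y} {I : Set ℝ} {t : ℝ} {y : Y}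
    (hf : HasDirDeriv f I t 1 y) (l : Y →L[ℝ] ℝ) : HasDerivWithinAt (fun s => l (f s)) (l y) I t := by
  rw [hasDerivWithinAt_iff_tendsto_slope]
  have h1 : Tendsto (fun s : ℝ => s - t) (𝓝[I \ {t}] t)
      (𝓝[{r : ℝ | r ≠ 0 ∧ t + r • (1 : ℝ) ∈ I}] 0) := by
    refine tendsto_nhdsWithin_iff.2 ⟨?_, ?_⟩
    · have h2 : Tendsto (fun s : ℝ => s - t) (𝓝 t) (𝓝 (t - t)) :=
        (continuous_id.sub continuous_const).tendsto t
      rw [sub_self] at h2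
      exact h2.mono_left nhdsWithin_le_nhds
    · filter_upwards [self_mem_nhdsWithin] with s hs
      exact ⟨sub_ne_zero.2 hs.2, by simpa using hs.1⟩
  have h3 := ((l.continuous.tendsto _).comp hf).comp h1
  refine h3.congr fun s => ?_
  simp [slope_def_module]

end Calculus

/-! ### Smooth maps between manifolds and the chain rule in charts -/

section Manifold

variable {E : Type u} [AddCommGroup E] [Module ℝ E] [TopologicalSpace E]
  [IsTopologicalAddGroup E] [ContinuousSMul ℝ E]
variable {F : Type v} [AddCommGroup F] [Module ℝ F] [TopologicalSpace F]
  [IsTopologicalAddGroup F] [ContinuousSMul ℝ F] [LocallyConvexSpace ℝ F] [T2Space F]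
variable {H : Type w} [AddCommGroup H] [Module ℝ H] [TopologicalSpace H]
  [IsTopologicalAddGroup H] [ContinuousSMul ℝ H] [LocallyConvexSpace ℝ H] [T2Space H]
variable {M : Type u₁} [TopologicalSpace M] [ChartedSpace E M]
variable {N : Type u₂} [TopologicalSpace N] [ChartedSpace F N]
variable {P : Type u₃} [TopologicalSpace P] [ChartedSpace H P]

theorem Smooth.id [IsLCManifold E M] : Smooth E E (fun x : M => x) :=
  ⟨continuous_id, IsLCManifold.smooth_chart_change⟩

theorem Smooth.fst [IsLCManifold E M] {E' : Type*} [AddCommGroup E'] [Module ℝ E']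
    [TopologicalSpace E'] {M' : Type*} [TopologicalSpace M'] [ChartedSpace E' M'] :
    Smooth (ModelProd E E') E (fun z : M × M' => z.1) := by
  refine ⟨continuous_fst, ?_⟩
  rintro _ ⟨e₁, he₁, e₂, he₂, rfl⟩ e' he' n
  exact ((Smooth.id (E := E) (M := M)).2 e₁ he₁ e' he' n).comp_linear
    (ContinuousLinearMap.fst ℝ E E') |>.mono fun z hz => ⟨hz.1.1, hz.2⟩

theorem Smooth.snd [IsLCManifold E M] {E' : Type*} [AddCommGroup E'] [Module ℝ E']
    [TopologicalSpace E'] {M' : Type*} [TopologicalSpace M'] [ChartedSpace E' M'] :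
    Smooth (ModelProd E' E) E (fun z : M' × M => z.2) := by
  refine ⟨continuous_snd, ?_⟩
  rintro _ ⟨e₁, he₁, e₂, he₂, rfl⟩ e' he' n
  exact ((Smooth.id (E := E) (M := M)).2 e₂ he₂ e' he' n).comp_linear
    (ContinuousLinearMap.snd ℝ E' E) |>.mono fun z hz => ⟨hz.1.2, hz.2⟩

theorem Smooth.hasDirDeriv_localRep {f : M → N} (hf : Smooth E F f)
    {e : OpenPartialHomeomorph M E} (he : e ∈ atlas E M) {e' : OpenPartialHomeomorph N F}
    (he' : e' ∈ atlas F N) {y : E} (hy : y ∈ localDom e e' f) (v : E) :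
    HasDirDeriv (localRep e e' f) (localDom e e' f) y v
      (dirDeriv (localRep e e' f) (localDom e e' f) y v) :=
  SmoothOn.hasDirDeriv (hf.2 e he e' he') (isOpen_localDom e e' hf.1).admitsDirections hy v

/-- The chain rule for a smooth map and a curve on `[0,1]`, in charts. -/
theorem Smooth.hasDirDeriv_curve {f : M → N} (hf : Smooth E F f) {γ : ℝ → M} (hγ : Continuous γ)
    {e : OpenPartialHomeomorph M E} (he : e ∈ atlas E M) {e' : OpenPartialHomeomorph N F}
    (he' : e' ∈ atlas F N) {I : Set ℝ} {t : ℝ} (ht : t ∈ I) (hte : γ t ∈ e.source)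
    (hte' : f (γ t) ∈ e'.source) {v : E} (hv : HasDirDeriv (fun s => e (γ s)) I t 1 v) :
    HasDirDeriv (fun s => e' (f (γ s))) I t 1
      (dirDeriv (localRep e e' f) (localDom e e' f) (e (γ t)) v) := by
  have hV : IsOpen (γ ⁻¹' (e.source ∩ f ⁻¹' e'.source)) :=
    (e.open_source.inter (e'.open_source.preimage hf.1)).preimage hγ
  have htV : t ∈ γ ⁻¹' (e.source ∩ f ⁻¹' e'.source) := ⟨hte, hte'⟩
  refine HasDirDeriv.of_inter hV htV ?_
  have hopen := isOpen_localDom e e' hf.1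
  have hmaps : MapsTo (fun s => e (γ s)) (I ∩ γ ⁻¹' (e.source ∩ f ⁻¹' e'.source))
      (localDom e e' f) := by
    rintro s ⟨-, hs1, hs2⟩
    refine ⟨e.map_source hs1, ?_⟩
    simpa only [mem_preimage, e.left_inv hs1] using hs2
  have h1 := HasDirDeriv.comp (dg := fun z => dirDeriv (localRep e e' f) (localDom e e' f) z.1 z.2)
    hopen hmaps (fun y hy k => hf.hasDirDeriv_localRep he he' hy k)
    ((SmoothOn.dirDeriv (hf.2 e he e' he') hopen.admitsDirections) 0) ⟨ht, htV⟩
    (hv.mono inter_subset_left)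
  refine h1.congr ⟨ht, htV⟩ ?_
  rintro s ⟨-, hs1, -⟩
  simp only [localRep, e.left_inv hs1]

/-- The chain rule for smooth maps, in charts. -/
theorem Smooth.dirDeriv_localRep_comp {g : N → P} {f : M → N} (hg : Smooth F H g)
    (hf : Smooth E F f) {e : OpenPartialHomeomorph M E} (he : e ∈ atlas E M)
    {e' : OpenPartialHomeomorph N F} (he' : e' ∈ atlas F N) {e'' : OpenPartialHomeomorph P H}
    (he'' : e'' ∈ atlas H P) {x : M} (hx : x ∈ e.source) (hx' : f x ∈ e'.source)
    (hx'' : g (f x) ∈ e''.source) (v : E) :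
    dirDeriv (localRep e' e'' g) (localDom e' e'' g) (e' (f x))
      (dirDeriv (localRep e e' f) (localDom e e' f) (e x) v) =
    dirDeriv (localRep e e'' fun x => g (f x)) (localDom e e'' fun x => g (f x)) (e x) v := by
  have hgf := hg.comp hf
  have hxl : e.symm (e x) = x := e.left_inv hx
  have m1 : e x ∈ localDom e e' f := ⟨e.map_source hx, by simpa only [mem_preimage, hxl]⟩
  have m2 : e x ∈ localDom e e'' fun x => g (f x) :=
    ⟨e.map_source hx, by simpa only [mem_preimage, hxl]⟩
  have o1 := isOpen_localDom e e' hf.1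
  have o2 := isOpen_localDom e e'' hgf.1
  have o3 := isOpen_localDom e' e'' hg.1
  have key : ∀ y ∈ localDom e e'' (fun x => g (f x)) ∩ localDom e e' f,
      e'.symm (localRep e e' f y) = f (e.symm y) := fun y hy => e'.left_inv hy.2.2
  have hmaps : MapsTo (localRep e e' f) (localDom e e'' (fun x => g (f x)) ∩ localDom e e' f)
      (localDom e' e'' g) := by
    intro y hy
    refine ⟨e'.map_source hy.2.2, ?_⟩
    simp only [mem_preimage, key y hy]
    exact hy.1.2
  have h1 := HasDirDeriv.comp
    (dg := fun z => dirDeriv (localRep e' e'' g) (localDom e' e'' g) z.1 z.2) o3 hmaps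
    (fun y hy k => hg.hasDirDeriv_localRep he' he'' hy k)
    ((SmoothOn.dirDeriv (hg.2 e' he' e'' he'') o3.admitsDirections) 0) ⟨m2, m1⟩
    ((hf.hasDirDeriv_localRep he he' m1 v).mono inter_subset_right)
  have h2 := HasDirDeriv.of_inter o1 m1 (h1.congr (g := localRep e e'' fun x => g (f x)) ⟨m2, m1⟩
    fun y hy => congrArg (fun z => e'' (g z)) (key y hy))
  have h3 : localRep e e' f (e x) = e' (f x) := congrArg (fun z => e' (f z)) hxl
  rw [h2.dirDeriv_eq o2.admitsDirections m2, h3]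

/-- Here f is the identity only up to a pointwise equation, so that the result applies to
compositions such as x ↦ a⁻¹ * (a * x). -/
theorem dirDeriv_localRep_self [T2Space E] (e : OpenPartialHomeomorph M E) {f : M → M}
    (hf : ∀ x, f x = x) {x : M} (hx : x ∈ e.source) (v : E) :
    dirDeriv (localRep e e f) (localDom e e f) (e x) v = v := by
  obtain rfl : f = fun x => x := funext hf
  have o := isOpen_localDom e e (f := fun x => x) continuous_id
  have m : e x ∈ localDom e e fun x => x :=
    ⟨e.map_source hx, by simpa only [mem_preimage, e.left_inv hx]⟩
  refine HasDirDeriv.dirDeriv_eq ?_ o.admitsDirections m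
  refine tendsto_const_nhds.congr' ?_
  filter_upwards [self_mem_nhdsWithin] with t ht
  simp only [localRep]
  rw [e.right_inv ht.2.1, e.left_inv hx, add_sub_cancel_left, inv_smul_smul₀ ht.1]

end Manifold

/-! ### Left logarithmic derivatives -/

section LogDeriv

variable (E : Type u) [AddCommGroup E] [Module ℝ E] [TopologicalSpace E]
variable {G : Type u₁} [TopologicalSpace G] [ChartedSpace E G] [Group G]

/-- The curve `γ` on `[0,1]` has the left logarithmic derivative `v ∈ T_1 G` at `t`. -/
def HasLogDeriv (γ : ℝ → G) (t : ℝ) (v : E) : Prop :=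
  HasDirDeriv (fun s => chartAt E (1 : G) ((γ t)⁻¹ * γ s)) (Icc 0 1) t 1 v

variable {E}
variable [IsTopologicalAddGroup E] [ContinuousSMul ℝ E] [LocallyConvexSpace ℝ E] [T2Space E]
variable [IsLCLieGroup E G]

theorem Smooth.mul {E' : Type*} [AddCommGroup E'] [Module ℝ E'] [TopologicalSpace E']
    [IsTopologicalAddGroup E'] [ContinuousSMul ℝ E'] {N : Type*} [TopologicalSpace N]
    [ChartedSpace E' N] {f g : N → G} (hf : Smooth E' E f) (hg : Smooth E' E g) :
    Smooth E' E (fun x => f x * g x) :=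
  (IsLCLieGroup.smooth_mul (E := E) (G := G)).comp (hf.prodMk hg)

theorem Smooth.inv {E' : Type*} [AddCommGroup E'] [Module ℝ E'] [TopologicalSpace E']
    [IsTopologicalAddGroup E'] [ContinuousSMul ℝ E'] {N : Type*} [TopologicalSpace N]
    [ChartedSpace E' N] {f : N → G} (hf : Smooth E' E f) :
    Smooth E' E (fun x => (f x)⁻¹) :=
  (IsLCLieGroup.smooth_inv (E := E) (G := G)).comp hf

variable (E) in
theorem smooth_mul_left (a : G) : Smooth E E (fun x : G => a * x) :=
  Smooth.mul (Smooth.const a) Smooth.id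

variable (E) in
/-- A curve with `γ'(t) = T_1(λ_(γ t)) v` has the logarithmic derivative `v` at `t`. -/
theorem SmoothPath.hasLogDeriv {η : unitInterval → G} (hη : SmoothPath E η) {t : unitInterval}
    {v : E} (hv : pathDeriv E η t = tangentMapAt E E (fun g : G => η t * g) 1 v) :
    HasLogDeriv E (extendPath η) t v := by
  have hc : Continuous (extendPath η) := hη.1.Icc_extend'
  have ht : extendPath η t = η t := extendPath_apply η t
  let e := chartAt E (η t)
  let e₁ := chartAt E (1 : G)
  have he : e ∈ atlas E G := chart_mem_atlas E _
  have he₁ : e₁ ∈ atlas E G := chart_mem_atlas E _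
  have hte : η t ∈ e.source := mem_chart_source E _
  have h1 : (1 : G) ∈ e₁.source := mem_chart_source E _
  have hV : IsOpen (extendPath η ⁻¹' e.source) := e.open_source.preimage hc
  have htV : (t : ℝ) ∈ extendPath η ⁻¹' e.source := by rwa [mem_preimage, ht]
  have hd := HasDirDeriv.of_inter hV htV ((hη.2 e he).hasDirDeriv
    (admitsDirections_Icc.inter_isOpen hV) ⟨t.2, htV⟩ 1)
  have hd2 := (smooth_mul_left E (η t)⁻¹).hasDirDeriv_curve hc he he₁ t.2 htV
    (by rw [ht, inv_mul_cancel]; exact h1) hd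
  have hv' : dirDeriv (fun s => e (extendPath η s)) (Icc 0 1 ∩ extendPath η ⁻¹' e.source) t 1 =
      dirDeriv (localRep e₁ e fun g => η t * g) (localDom e₁ e fun g => η t * g) (e₁ 1) v := by
    simpa only [tangentMapAt, pathDeriv, mul_one] using hv
  have hm : e (extendPath η t) = e (η t * 1) := by rw [ht, mul_one]
  -- Left translations by η(t) and by its inverse compose to the identity, so their tangent maps
  -- cancel and v remains.
  rw [hv', hm, Smooth.dirDeriv_localRep_comp (smooth_mul_left E (η t)⁻¹) (smooth_mul_left E (η t))
    he₁ he he₁ h1 (by rwa [mul_one]) (by rwa [mul_one, inv_mul_cancel]),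
    dirDeriv_localRep_self e₁ (fun x => inv_mul_cancel_left _ _) h1] at hd2
  rw [HasLogDeriv, ht]
  exact hd2

/-- Smooth homomorphisms are compatible with logarithmic derivatives. -/
theorem HasLogDeriv.map {E' : Type*} [AddCommGroup E'] [Module ℝ E'] [TopologicalSpace E']
    [IsTopologicalAddGroup E'] [ContinuousSMul ℝ E'] [LocallyConvexSpace ℝ E'] [T2Space E']
    {K : Type*} [TopologicalSpace K] [ChartedSpace E' K] [Group K] [IsLCLieGroup E' K]
    {f : G →* K} (hf : Smooth E E' f) {γ : ℝ → G} (hγ : Continuous γ) {t : ℝ} (ht : t ∈ Icc 0 1)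
    {v : E} (hv : HasLogDeriv E γ t v) :
    HasLogDeriv E' (fun s => f (γ s)) t (tangentMapAt E E' f 1 v) := by
  have h1 : (γ t)⁻¹ * γ t = 1 := inv_mul_cancel _
  have hc : Continuous fun s => (γ t)⁻¹ * γ s := (smooth_mul_left E (γ t)⁻¹).1.comp hγ
  have h2 := hf.hasDirDeriv_curve hc (chart_mem_atlas E (1 : G)) (chart_mem_atlas E' (1 : K)) ht
    (by rw [h1]; exact mem_chart_source E _)
    (by rw [h1, map_one]; exact mem_chart_source E' _) hv
  simp only [h1, map_mul, map_inv] at h2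
  simpa only [HasLogDeriv, tangentMapAt, map_one] using h2

/-- A curve whose derivatives in charts vanish is constant. -/
theorem eq_of_hasDirDeriv_zero {c : ℝ → G} (hc : Continuous c)
    (h : ∀ t ∈ Icc (0 : ℝ) 1, ∀ e ∈ atlas E G, c t ∈ e.source →
      HasDirDeriv (fun s => e (c s)) (Icc 0 1) t 1 0) (t : unitInterval) : c t = c 0 := by
  have hloc : IsLocallyConstant fun t : unitInterval => c t := by
    rw [IsLocallyConstant.iff_eventually_eq]
    intro t₀
    let e := chartAt E (c t₀)
    have he : c t₀ ∈ e.source := mem_chart_source E _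
    obtain ⟨r, hr, hrV⟩ := Metric.mem_nhds_iff.1 ((e.open_source.preimage hc).mem_nhds he)
    have hball : Subtype.val ⁻¹' Metric.ball (t₀ : ℝ) r ∈ 𝓝 t₀ :=
      continuous_subtype_val.continuousAt (Metric.ball_mem_nhds _ hr)
    filter_upwards [hball] with t ht
    refine e.injOn (hrV ht) he ?_
    by_contra hne
    -- Inside one chart, l ∘ e ∘ c has zero derivative near t₀, so l cannot separate the two values.
    -- Hence c is locally constant, and [0,1] is connected.
    obtain ⟨l, hl⟩ := geometric_hahn_banach_point_point hne
    refine hl.ne ?_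
    have hconv : Convex ℝ (Icc (0 : ℝ) 1 ∩ Metric.ball (t₀ : ℝ) r) :=
      (convex_Icc 0 1).inter (convex_ball _ _)
    have := hconv.norm_image_sub_le_of_norm_hasDerivWithin_le (f := fun s => l (e (c s)))
      (f' := fun _ => 0) (C := 0) (fun s hs => ?_) (fun s hs => by simp)
      ⟨t₀.2, Metric.mem_ball_self hr⟩ ⟨t.2, ht⟩
    · rwa [zero_mul, norm_le_zero_iff, sub_eq_zero] at this
    · have h1 := (h s hs.1 e (chart_mem_atlas E _) (hrV hs.2)).hasDerivWithinAt l
      rw [map_zero] at h1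
      exact h1.mono inter_subset_left
  exact hloc.apply_eq_of_preconnectedSpace t 0

/-- A curve is determined by its logarithmic derivative and its initial value. -/
theorem HasLogDeriv.eq_of_eq {γ η : ℝ → G} (hγ : Continuous γ) (hη : Continuous η) {ξ : ℝ → E}
    (h1 : ∀ t ∈ Icc (0 : ℝ) 1, HasLogDeriv E γ t (ξ t))
    (h2 : ∀ t ∈ Icc (0 : ℝ) 1, HasLogDeriv E η t (ξ t)) (h0 : γ 0 = η 0) (t : unitInterval) :
    γ t = η t := by
  have hcont : Continuous fun s => γ s * (η s)⁻¹ :=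
    (IsLCLieGroup.smooth_mul (E := E) (G := G)).1.comp
      (hγ.prodMk ((IsLCLieGroup.smooth_inv (E := E) (G := G)).1.comp hη))
  -- The quotient s ↦ γ(s) η(s)⁻¹ is shown to have zero derivative; it starts at 1.
  have key := eq_of_hasDirDeriv_zero (E := E) hcont (fun t ht e he hte => ?_) t
  · simp only [h0, mul_inv_cancel] at key
    exact mul_inv_eq_one.1 key
  let e₁ := chartAt E (1 : G)
  -- The quotient curve is f(γ(t)⁻¹ γ(s), η(t)⁻¹ η(s)), and the inner curve in G × G has velocity (ξ
  -- t, ξ t) at (1, 1).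
  let f : G × G → G := fun z => γ t * (z.1 * z.2⁻¹) * (η t)⁻¹
  have hf : Smooth (ModelProd E E) E f :=
    Smooth.mul (Smooth.mul (Smooth.const _) (Smooth.mul Smooth.fst (Smooth.inv Smooth.snd)))
      (Smooth.const _)
  have hce : (e₁.prod e₁ : OpenPartialHomeomorph (G × G) (ModelProd E E)) ∈
      atlas (ModelProd E E) (G × G) :=
    ⟨e₁, chart_mem_atlas E _, e₁, chart_mem_atlas E _, rfl⟩
  have hκ : Continuous fun s => ((γ t)⁻¹ * γ s, (η t)⁻¹ * η s) :=
    ((smooth_mul_left E _).1.comp hγ).prodMk ((smooth_mul_left E _).1.comp hη)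
  have hs1 : (1 : G) ∈ e₁.source := mem_chart_source E _
  have hsrc : ((γ t)⁻¹ * γ t, (η t)⁻¹ * η t) ∈ (e₁.prod e₁).source := by
    simpa using hs1
  have hft : f ((γ t)⁻¹ * γ t, (η t)⁻¹ * η t) = γ t * (η t)⁻¹ := by simp [f]
  have hd := hf.hasDirDeriv_curve hκ hce he ht hsrc (by rwa [hft])
    (HasDirDeriv.prodMk (h1 t ht) (h2 t ht))
  -- f is constant on the diagonal, so its derivative along diagonal directions vanishes.
  have hz : dirDeriv (localRep (e₁.prod e₁) e f) (localDom (e₁.prod e₁) e f)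
      ((e₁.prod e₁) ((γ t)⁻¹ * γ t, (η t)⁻¹ * η t)) (ξ t, ξ t) = 0 := by
    have hmem : (e₁.prod e₁) ((γ t)⁻¹ * γ t, (η t)⁻¹ * η t) ∈ localDom (e₁.prod e₁) e f := by
      refine ⟨(e₁.prod e₁).map_source hsrc, ?_⟩
      rw [mem_preimage, mem_preimage, (e₁.prod e₁).left_inv hsrc, hft]
      exact hte
    refine HasDirDeriv.dirDeriv_eq ?_
      (isOpen_localDom (e₁.prod e₁) e hf.1).admitsDirections hmem
    refine tendsto_const_nhds.congr fun r => ?_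
    have hrep : ∀ y : E, localRep (e₁.prod e₁) e f (y, y) = e (γ t * (η t)⁻¹) := by
      intro y
      simp [localRep, f]
    have hbase : (e₁.prod e₁) ((γ t)⁻¹ * γ t, (η t)⁻¹ * η t) = (e₁ 1, e₁ 1) := by simp
    rw [hbase, Prod.smul_mk, Prod.mk_add_mk, hrep, hrep, sub_self, smul_zero]
  have hd' : HasDirDeriv (fun s => e (f ((γ t)⁻¹ * γ s, (η t)⁻¹ * η s))) (Icc 0 1) t 1 0 := by
    rw [← hz]
    exact hd
  refine hd'.congr ht fun s _ => ?_
  simp [f, mul_assoc]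

end LogDeriv

/-! ### Segments in the chart at the identity -/

section Segments

variable {E : Type u} [AddCommGroup E] [Module ℝ E] [TopologicalSpace E]
  [IsTopologicalAddGroup E] [ContinuousSMul ℝ E] [LocallyConvexSpace ℝ E] [T2Space E]
variable (G : Type u₁) [TopologicalSpace G] [ChartedSpace E G] [Group G] [IsLCLieGroup E G]

/-- The parameters `(p, t)` for which the point at time `t` of the segment from `e 1` to `p` lies in
the domain of the chart `e` at `1`. -/
def segmentDom : Set (E × ℝ) :=
  {z | chartAt E (1 : G) 1 + z.2 • (z.1 - chartAt E (1 : G) 1) ∈ (chartAt E (1 : G)).target}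

/-- The logarithmic derivative at time `t` of the curve in `G` that is the segment from `e 1` to `p`
in the chart `e` at `1`. -/
noncomputable def segmentLogDeriv (z : E × ℝ) : E :=
  let e := chartAt E (1 : G)
  let x := e 1 + z.2 • (z.1 - e 1)
  dirDeriv (X := E × E) (localRep (e.prod e) e fun z : G × G => z.1⁻¹ * z.2)
    (localDom (e.prod e) e fun z : G × G => z.1⁻¹ * z.2) (x, x) (0, z.1 - e 1)

theorem isOpen_segmentDom : IsOpen (segmentDom (E := E) G) :=
  (chartAt E (1 : G)).open_target.preimage (by fun_prop)

theorem smooth_inv_mul : Smooth (ModelProd E E) E fun z : G × G => z.1⁻¹ * z.2 :=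
  Smooth.mul (Smooth.inv Smooth.fst) Smooth.snd

variable {G} in
theorem diag_mem_localDom {x : E} (hx : x ∈ (chartAt E (1 : G)).target) :
    (x, x) ∈ localDom ((chartAt E (1 : G)).prod (chartAt E (1 : G))) (chartAt E (1 : G))
      (fun z : G × G => z.1⁻¹ * z.2) := by
  refine ⟨⟨hx, hx⟩, ?_⟩
  simp

theorem smoothOn_localRep_inv_mul : SmoothOn (X := E × E)
    (localRep ((chartAt E (1 : G)).prod (chartAt E (1 : G))) (chartAt E (1 : G))
      fun z : G × G => z.1⁻¹ * z.2)
    (localDom ((chartAt E (1 : G)).prod (chartAt E (1 : G))) (chartAt E (1 : G))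
      fun z : G × G => z.1⁻¹ * z.2) :=
  (smooth_inv_mul G).2 _ ⟨_, chart_mem_atlas E _, _, chart_mem_atlas E _, rfl⟩ _
    (chart_mem_atlas E _)

theorem isOpen_localDom_inv_mul : IsOpen (X := E × E)
    (localDom ((chartAt E (1 : G)).prod (chartAt E (1 : G))) (chartAt E (1 : G))
      fun z : G × G => z.1⁻¹ * z.2) :=
  isOpen_localDom _ _ (smooth_inv_mul (E := E) G).1

/-- The derivative of the smooth map (a, b) ↦ a⁻¹ b is evaluated at arguments smooth in (p, t).
Joint smoothness is what the exponential law asks for. -/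
theorem smoothOn_segmentLogDeriv : SmoothOn (segmentLogDeriv (E := E) G) (segmentDom G) := by
  intro n
  have hopen := isOpen_localDom_inv_mul (E := E) G
  have h1 := (smoothOn_localRep_inv_mul (E := E) G).dirDeriv hopen.admitsDirections n
  have hv : CnOn n (fun z : E × ℝ => z.1 - chartAt E (1 : G) 1) (segmentDom G) :=
    CnOn.linear_comp (ContinuousLinearMap.fst ℝ E E - ContinuousLinearMap.snd ℝ E E)
      ((CnOn.continuousLinearMap (ContinuousLinearMap.fst ℝ E ℝ) _).prodMk
        (CnOn.const (chartAt E (1 : G) 1) _))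
  have hx : CnOn n (fun z : E × ℝ => chartAt E (1 : G) 1 + z.2 • (z.1 - chartAt E (1 : G) 1))
      (segmentDom G) :=
    CnOn.linear_comp (ContinuousLinearMap.fst ℝ E E + ContinuousLinearMap.snd ℝ E E)
      ((CnOn.const (chartAt E (1 : G) 1) _).prodMk
        ((CnOn.continuousLinearMap (ContinuousLinearMap.snd ℝ E ℝ) _).smul hv))
  have h2 := CnOn.comp (hopen.prod isOpen_univ) h1
    ((hx.prodMk hx).prodMk ((CnOn.const (0 : E) _).prodMk hv))
    fun z hz => ⟨diag_mem_localDom hz, trivial⟩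
  exact h2

/-- The curve in `G` that is the segment from `e 1` to `p` in the chart `e` at `1`. -/
noncomputable def segmentPath (p : E) (t : unitInterval) : G :=
  (chartAt E (1 : G)).symm (chartAt E (1 : G) 1 + (t : ℝ) • (p - chartAt E (1 : G) 1))

variable {G}

theorem continuous_segmentPath {p : E} (hp : ∀ t ∈ Icc (0 : ℝ) 1, (p, t) ∈ segmentDom G) :
    Continuous (segmentPath G p) := by
  refine ContinuousOn.comp_continuous (chartAt E (1 : G)).continuousOn_symm ?_ fun t => hp t t.2
  fun_prop

/-- In c(t)⁻¹ c(s) the first factor is frozen and the second moves along the segment with velocity p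
- e 1. This is the direction (0, p - e 1) in the chart of G × G. -/
theorem hasLogDeriv_segmentPath {p : E} (hp : ∀ t ∈ Icc (0 : ℝ) 1, (p, t) ∈ segmentDom G)
    {t : ℝ} (ht : t ∈ Icc (0 : ℝ) 1) :
    HasLogDeriv E (extendPath (segmentPath G p)) t (segmentLogDeriv G (p, t)) := by
  have hopen := isOpen_localDom_inv_mul (E := E) G
  have hmem := diag_mem_localDom (hp t ht)
  have h1 := (smoothOn_localRep_inv_mul (E := E) G).hasDirDeriv hopen.admitsDirections hmem
    (0, p - chartAt E (1 : G) 1)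
  have h2 := HasDirDeriv.of_inter (U := univ) hopen hmem (by rwa [univ_inter])
  have h3 : Tendsto _ (𝓝[{r : ℝ | r ≠ 0 ∧ t + r • (1 : ℝ) ∈ Icc (0 : ℝ) 1}] 0) _ :=
    h2.mono_left (nhdsWithin_mono _ fun r hr => ⟨hr.1, trivial⟩)
  refine h3.congr' ?_
  filter_upwards [self_mem_nhdsWithin] with r hr
  have e1 : extendPath (segmentPath G p) t = segmentPath G p ⟨t, ht⟩ :=
    extendPath_apply _ (⟨t, ht⟩ : unitInterval)
  have e2 : extendPath (segmentPath G p) (t + r • (1 : ℝ)) = segmentPath G p ⟨_, hr.2⟩ :=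
    extendPath_apply _ (⟨_, hr.2⟩ : unitInterval)
  simp only [e1, e2]
  simp only [segmentPath, localRep, Prod.smul_mk, Prod.mk_add_mk, smul_zero, add_zero,
    OpenPartialHomeomorph.prod_symm_apply, smul_eq_mul, mul_one, add_smul, add_assoc]

end Segments

/-! ### Smoothness of homomorphisms into a regular Lie group -/

section Rigidity

theorem exists_isOpen_convex_subset {X : Type*} [AddCommGroup X] [Module ℝ X] [TopologicalSpace X]
    [IsTopologicalAddGroup X] [ContinuousSMul ℝ X] [LocallyConvexSpace ℝ X] {U : Set X}
    (hU : IsOpen U) {x : X} (hx : x ∈ U) : ∃ W, IsOpen W ∧ x ∈ W ∧ Convex ℝ W ∧ W ⊆ U := by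
  obtain ⟨V, ⟨hV, hVc⟩, hVU⟩ :=
    (LocallyConvexSpace.convex_basis (𝕜 := ℝ) x).mem_iff.1 (hU.mem_nhds hx)
  exact ⟨interior V, isOpen_interior, mem_interior_iff_mem_nhds.2 hV, hVc.interior,
    interior_subset.trans hVU⟩

variable {E₁ : Type u} [AddCommGroup E₁] [Module ℝ E₁] [TopologicalSpace E₁]
  [IsTopologicalAddGroup E₁] [ContinuousSMul ℝ E₁] [LocallyConvexSpace ℝ E₁] [T2Space E₁]
variable {E₂ : Type v} [AddCommGroup E₂] [Module ℝ E₂] [TopologicalSpace E₂]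
  [IsTopologicalAddGroup E₂] [ContinuousSMul ℝ E₂] [LocallyConvexSpace ℝ E₂] [T2Space E₂]
variable {E : Type w} [AddCommGroup E] [Module ℝ E] [TopologicalSpace E]
  [IsTopologicalAddGroup E] [ContinuousSMul ℝ E] [LocallyConvexSpace ℝ E] [T2Space E]
variable {G₁ : Type u₁} [TopologicalSpace G₁] [ChartedSpace E₁ G₁] [Group G₁] [IsLCLieGroup E₁ G₁]
variable {G₂ : Type u₂} [TopologicalSpace G₂] [ChartedSpace E₂ G₂] [Group G₂] [IsLCLieGroup E₂ G₂]
variable {K : Type u₃} [TopologicalSpace K] [ChartedSpace E K] [Group K] [IsLCLieGroup E K]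

/-- A homomorphism of Lie groups is smooth if, in the chart at `1`, it coincides near `1` with the
composition of a smooth map into a topological vector space `Q` and a smooth map on `Q`. -/
theorem Smooth.of_local_factor {Q : Type*} [AddCommGroup Q] [Module ℝ Q] [TopologicalSpace Q]
    [IsTopologicalAddGroup Q] [ContinuousSMul ℝ Q] {φ : G₁ →* G₂} {W : Set E₁} (hW : IsOpen W)
    (h1 : chartAt E₁ (1 : G₁) 1 ∈ W) {f : E₁ → Q}
    (hf : SmoothOn f W) {T : Q → G₂} (hT : Smooth Q E₂ T)
    (hφ : ∀ p ∈ W, T (f p) = φ ((chartAt E₁ (1 : G₁)).symm p)) : Smooth E₁ E₂ φ := by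
  let e₁ := chartAt E₁ (1 : G₁)
  let O : G₁ → Set G₁ := fun g₀ => (fun g => g₀⁻¹ * g) ⁻¹' (e₁.source ∩ e₁ ⁻¹' W)
  have hO : ∀ g₀, IsOpen (O g₀) := fun g₀ =>
    (e₁.isOpen_inter_preimage hW).preimage (smooth_mul_left E₁ g₀⁻¹).1
  have hmemO : ∀ g₀, g₀ ∈ O g₀ := fun g₀ => by
    change g₀⁻¹ * g₀ ∈ e₁.source ∩ e₁ ⁻¹' W
    rw [inv_mul_cancel]
    exact ⟨mem_chart_source E₁ _, h1⟩
  have hTg : ∀ g₀, Smooth Q E₂ (fun q => φ g₀ * T q) := fun g₀ =>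
    (smooth_mul_left E₂ (φ g₀)).comp hT
  -- The homomorphism property transports the factorization at 1 to the translated neighbourhood `O
  -- g₀` of g₀.
  have hloc : ∀ g₀, ∀ g ∈ O g₀, φ g₀ * T (f (e₁ (g₀⁻¹ * g))) = φ g := by
    intro g₀ g hg
    rw [hφ _ hg.2, e₁.left_inv hg.1, map_mul, map_inv, mul_inv_cancel_left]
  have hcont : Continuous φ := by
    refine continuous_iff_continuousAt.2 fun g₀ => ?_
    have h2 : ContinuousOn (fun g => φ g₀ * T (f (e₁ (g₀⁻¹ * g)))) (O g₀) := by
      refine (hTg g₀).1.comp_continuousOn ((hf 0).continuousOn.comp ?_ fun g hg => hg.2)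
      exact e₁.continuousOn.comp (smooth_mul_left E₁ g₀⁻¹).1.continuousOn fun g hg => hg.1
    exact ((h2.congr fun g hg => (hloc g₀ g hg).symm).continuousAt
      ((hO g₀).mem_nhds (hmemO g₀)))
  refine ⟨hcont, fun e he e' he' n => CnOn.of_local (isOpen_localDom e e' hcont) fun x hx => ?_⟩
  let g₀ := e.symm x
  refine ⟨e.target ∩ e.symm ⁻¹' O g₀, e.isOpen_inter_preimage_symm (hO g₀),
    ⟨hx.1, hmemO g₀⟩, ?_⟩
  have hl : CnOn n (localRep e e₁ fun g => g₀⁻¹ * g)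
      (localDom e e' φ ∩ (e.target ∩ e.symm ⁻¹' O g₀)) :=
    ((smooth_mul_left E₁ g₀⁻¹).2 e he e₁ (chart_mem_atlas E₁ _) n).mono
      fun y hy => ⟨hy.1.1, hy.2.2.1⟩
  have hTn := (hTg g₀).2 (OpenPartialHomeomorph.refl Q) (chartedSpaceSelf_atlas.2 rfl) e' he' n
  have hV : IsOpen (W ∩ (fun p => φ g₀ * T (f p)) ⁻¹' e'.source) :=
    ((hTg g₀).1.comp_continuousOn (hf 0).continuousOn).isOpen_inter_preimage hW e'.open_source
  have hTf := CnOn.comp (isOpen_localDom _ e' (hTg g₀).1) hTn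
    ((hf n).mono (W := W ∩ (fun p => φ g₀ * T (f p)) ⁻¹' e'.source) inter_subset_left)
    fun p hp => ⟨trivial, hp.2⟩
  refine (CnOn.comp hV hTf hl ?_).congr ?_
  · intro y hy
    refine ⟨hy.2.2.2, ?_⟩
    change φ g₀ * T (f (e₁ (g₀⁻¹ * e.symm y))) ∈ e'.source
    rw [hloc g₀ _ hy.2.2]
    exact hy.1.2
  · intro y hy
    exact congrArg e' (hloc g₀ _ hy.2.2)

/-- A homomorphism `φ` into a regular Lie group `G₂` is smooth if a point separating family of smooth
homomorphisms `g m` on `G₂` has smooth composites `g m ∘ φ = f m`, and some continuous linear map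
`L` between the Lie algebras satisfies `L(g m) ∘ L = L(f m)`. -/
theorem IsRegular.smooth_of_separating (hG₂ : IsRegular E₂ G₂) (φ : G₁ →* G₂) (L : E₁ →L[ℝ] E₂)
    {ι : Type*} (f : ι → G₁ →* K) (g : ι → G₂ →* K) (hf : ∀ m, Smooth E₁ E (f m))
    (hg : ∀ m, Smooth E₂ E (g m)) (hgφ : ∀ m x, g m (φ x) = f m x)
    (hsep : ∀ x y, (∀ m, g m x = g m y) → x = y)
    (hL : ∀ m v, tangentMapAt E₂ E (g m) 1 (L v) = tangentMapAt E₁ E (f m) 1 v) :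
    Smooth E₁ E₂ φ := by
  obtain ⟨Evol, hEvol, hsmooth⟩ := hG₂
  let e := chartAt E₁ (1 : G₁)
  have h1 : e 1 ∈ e.target := e.map_source (mem_chart_source E₁ _)
  -- Convexity keeps the segment from e 1 to each p ∈ W inside the chart.
  obtain ⟨W, hWo, h1W, hWc, hWt⟩ := exists_isOpen_convex_subset e.open_target h1
  have hWdom : W ×ˢ Icc (0 : ℝ) 1 ⊆ segmentDom G₁ := by
    rintro ⟨p, t⟩ ⟨hp, ht⟩
    exact hWt (hWc.add_smul_sub_mem h1W hp ht)
  have hΨ : SmoothOn (fun z => L (segmentLogDeriv G₁ z)) (segmentDom G₁) := fun n =>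
    CnOn.linear_comp L (smoothOn_segmentLogDeriv G₁ n)
  have hcurve : ∀ p ∈ W, SmoothOn (fun t => L (segmentLogDeriv G₁ (p, t))) (Icc 0 1) :=
    fun p hp => hΨ.partial_snd (isOpen_segmentDom G₁) fun t ht => hWdom ⟨hp, ht⟩
  classical
  let F : E₁ → PathSpace E₂ := fun p => if hp : p ∈ W then PathSpace.mk _ (hcurve p hp) else 0
  have hF : ∀ p ∈ W, ∀ t : unitInterval, (F p).1 t = L (segmentLogDeriv G₁ (p, t)) := by
    intro p hp t
    simp only [F, hp, dif_pos]
    exact PathSpace.mk_apply _ (hcurve p hp) t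
  -- The intermediate space is Q = C^∞([0,1], E₂) and T is the time-one evolution. What remains is
  -- that the evolution of `F p` ends at the image under φ of the point with coordinate p, and this
  -- is tested after each `g m`.
  refine Smooth.of_local_factor hWo h1W
    (fun n => CnOn.curry (isOpen_segmentDom G₁) hWdom hΨ hF) hsmooth fun p hp => hsep _ _ fun m => ?_
  obtain ⟨hsm, h0, hder⟩ := hEvol (F p)
  have hpd : ∀ t ∈ Icc (0 : ℝ) 1, (p, t) ∈ segmentDom G₁ := fun t ht => hWdom ⟨hp, ht⟩
  have hc₁ : Continuous (extendPath (segmentPath G₁ p)) :=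
    (continuous_segmentPath hpd).Icc_extend'
  have hc₂ : Continuous (extendPath (Evol (F p))) := hsm.1.Icc_extend'
  -- Both image curves in K start at 1. Their logarithmic derivatives are L(g m)(L v) and L(f m)(v),
  -- with v that of the segment, and these agree by `hL`.
  have key := HasLogDeriv.eq_of_eq (E := E) (γ := fun s => g m (extendPath (Evol (F p)) s))
    (η := fun s => f m (extendPath (segmentPath G₁ p) s))
    (ξ := fun t => tangentMapAt E₁ E (f m) 1 (segmentLogDeriv G₁ (p, t)))
    ((hg m).1.comp hc₂) ((hf m).1.comp hc₁) (fun t ht => ?_)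
    (fun t ht => (hasLogDeriv_segmentPath hpd ht).map (hf m) hc₁ ht) ?_ 1
  · simp only [extendPath_apply] at key
    rw [key, hgφ]
    simp [segmentPath]
  · have h2 := (SmoothPath.hasLogDeriv E₂ hsm (hder ⟨t, ht⟩)).map (hg m) hc₂ ht
    rw [hF p hp, hL] at h2
    exact h2
  · have e1 : extendPath (Evol (F p)) 0 = 1 := (extendPath_apply _ 0).trans h0
    have e2 : extendPath (segmentPath G₁ p) 0 = 1 := by
      refine (extendPath_apply _ 0).trans ?_
      simp [segmentPath, (chartAt E₁ (1 : G₁)).left_inv (mem_chart_source E₁ _)]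
    simp only [e1, e2, map_one]

end Rigidity

/-! ### Application to the evaluations on the mapping group -/

section Main

variable {F : Type u} [AddCommGroup F] [Module ℝ F] [TopologicalSpace F]
  [IsTopologicalAddGroup F] [ContinuousSMul ℝ F]
variable {M : Type u₁} [TopologicalSpace M] [ChartedSpace F M]
variable {E : Type v} [AddCommGroup E] [Module ℝ E] [TopologicalSpace E]
  [IsTopologicalAddGroup E] [ContinuousSMul ℝ E] [LocallyConvexSpace ℝ E] [T2Space E]
variable {K : Type u₂} [TopologicalSpace K] [ChartedSpace E K] [Group K] [IsLCLieGroup E K]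

/-- The evaluation `ev_m : C^∞(M,K) → K`, as a homomorphism. -/
def evalHom {E' : Type*} [AddCommGroup E'] [Module ℝ E'] [TopologicalSpace E']
    (S : LieGroupStructure E' (MappingGroup F M E K)) (m : M) : S.Space →* K where
  toFun := evalAt S m
  map_one' := rfl
  map_mul' := fun _ _ => rfl

/-- The identity is smooth from a Lie group structure compatible with evaluations to a regular
one. -/
theorem CompatibleWithEvaluations.smooth_idMap
    {E₁ : Type*} [AddCommGroup E₁] [Module ℝ E₁] [TopologicalSpace E₁]
    [IsTopologicalAddGroup E₁] [ContinuousSMul ℝ E₁] [LocallyConvexSpace ℝ E₁] [T2Space E₁]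
    {E₂ : Type*} [AddCommGroup E₂] [Module ℝ E₂] [TopologicalSpace E₂]
    [IsTopologicalAddGroup E₂] [ContinuousSMul ℝ E₂] [LocallyConvexSpace ℝ E₂] [T2Space E₂]
    {S₁ : LieGroupStructure E₁ (MappingGroup F M E K)}
    {S₂ : LieGroupStructure E₂ (MappingGroup F M E K)}
    (hc₁ : CompatibleWithEvaluations S₁) (hc₂ : CompatibleWithEvaluations S₂)
    (hS₂ : IsRegular E₂ S₂.Space) : Smooth E₁ E₂ (S₁.idMap S₂) := by
  obtain ⟨hev₁, θ₁, -, hθ₁⟩ := hc₁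
  obtain ⟨hev₂, θ₂, -, hθ₂⟩ := hc₂
  let φ : S₁.Space →* S₂.Space :=
    { toFun := S₁.idMap S₂, map_one' := rfl, map_mul' := fun _ _ => rfl }
  -- With L = θ₂⁻¹ ∘ θ₁, both tangent maps of ev_m send v to the value of θ₁ v at m. Evaluations
  -- separate points because elements of the group are functions on M.
  refine hS₂.smooth_of_separating (E := E) (K := K) φ
    ((θ₁.trans θ₂.symm : E₁ ≃L[ℝ] E₂) : E₁ →L[ℝ] E₂) (evalHom S₁) (evalHom S₂) hev₁ hev₂
    (fun _ _ => rfl) (fun x y h => Subtype.ext (funext h)) fun m v => ?_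
  refine (hθ₂ m _).trans (Eq.trans ?_ (hθ₁ m v).symm)
  simp

end Main

end LCCalculus

/-- For a connected finite-dimensional manifold `M` and a regular Lie group `K`, any two regular Lie
group structures on `C^∞(M,K)` that are compatible with evaluations coincide. -/
theorem corollaryI10
    {F : Type*} [NormedAddCommGroup F] [NormedSpace ℝ F] [FiniteDimensional ℝ F]
    {M : Type*} [TopologicalSpace M] [T2Space M] [ConnectedSpace M] [ChartedSpace F M]
    [LCCalculus.IsLCManifold F M]
    {E : Type*} [AddCommGroup E] [Module ℝ E] [TopologicalSpace E] [IsTopologicalAddGroup E]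
    [ContinuousSMul ℝ E] [LocallyConvexSpace ℝ E] [T2Space E]
    {K : Type*} [TopologicalSpace K] [ChartedSpace E K] [Group K] [LCCalculus.IsLCLieGroup E K]
    (hK : LCCalculus.IsRegular E K)
    {E₁ : Type*} [AddCommGroup E₁] [Module ℝ E₁] [TopologicalSpace E₁] [IsTopologicalAddGroup E₁]
    [ContinuousSMul ℝ E₁] [LocallyConvexSpace ℝ E₁] [T2Space E₁]
    {E₂ : Type*} [AddCommGroup E₂] [Module ℝ E₂] [TopologicalSpace E₂] [IsTopologicalAddGroup E₂]
    [ContinuousSMul ℝ E₂] [LocallyConvexSpace ℝ E₂] [T2Space E₂]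
    (S₁ : LCCalculus.LieGroupStructure E₁ (LCCalculus.MappingGroup F M E K))
    (hS₁ : LCCalculus.IsRegular E₁ S₁.Space)
    (hc₁ : LCCalculus.CompatibleWithEvaluations S₁)
    (S₂ : LCCalculus.LieGroupStructure E₂ (LCCalculus.MappingGroup F M E K))
    (hS₂ : LCCalculus.IsRegular E₂ S₂.Space)
    (hc₂ : LCCalculus.CompatibleWithEvaluations S₂) :
    S₁.Same S₂ := by
  exact ⟨hc₁.smooth_idMap hc₂ hS₂, hc₂.smooth_idMap hc₁ hS₁⟩
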